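/- Let $N\ge 4$ be an integer and let $p$ be a real number with $$\frac{N+1}{N-3}<p<p_{JL}(N-1),\qquad p_{JL}(M):=\begin{cases}1+\dfrac{4}{M-4-2\sqrt{M-1}} & \text{if } M\ge 11,\\[1ex] \infty & \text{if } 2\le M\le 10,\end{cases}$$ and put $\mu:=\frac{2}{p-1}\left(N-2-\frac{2}{p-1}\right)$. Fix a pole $e\in\mathbb{S}^{N-1}$; a function on $\mathbb{S}^{N-1}$ is called axially symmetric (radial) if it depends only on the geodesic distance from $e$. Then the equation $$\Delta_{\mathbb{S}^{N-1}}V-\mu V+V^p=0\quad\text{on }\mathbb{S}^{N-1},$$ where $\Delta_{\mathbb{S}^{N-1}}$ is the Laplace–Beltrami operator of the unit sphere, has infinitely many positive axially symmetric classical ($C^2$) solutions $V$. Consequently, the Lane–Emden equation $$\Delta U+U^p=0\quad\text{in }\mathbb{R}^N\setminus\{0\}$$ has infinitely many positive classical solutions $U\in C^2(\mathbb{R}^N\setminus\{0\})$ that are singular at the origin ($U(x)\to\infty$ as $x\to0$), are nonradial (not functions of $|x|$ alone), and have the form $U(x)=|x|^{-2/(p-1)}\,V(x/|x|)$, where $V$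 is a positive axially symmetric solution, with respect to the same pole $e$, of the equation on the sphere. -/

import Mathlib

open Set Metric Filter Topology InnerProductSpace
open scoped Manifold ContDiff

namespace SingularLaneEmden

noncomputable section

/-- `ℝ^N` with the Euclidean norm. -/
abbrev Space (N : ℕ) : Type := EuclideanSpace ℝ (Fin N)

/-- The unit sphere `𝕊^{N-1}` of `ℝ^N`. -/
abbrev Sphere (N : ℕ) : Type := sphere (0 : Space N) 1

/-- `ℝ^N` has dimension `(N - 1) + 1`; this makes `𝕊^{N-1}` a smooth manifold of
dimension `N - 1`. -/
instance factFinrank (N : ℕ) [NeZero N] : Fact (Module.finrank ℝ (Space N) = (N - 1) + 1) :=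
  ⟨by
    rw [finrank_euclideanSpace_fin]
    have := NeZero.ne N
    omega⟩

/-- The point `x / |x|` of the sphere, for `x ≠ 0`. -/
def direction {N : ℕ} (x : Space N) (hx : x ≠ 0) : Sphere N :=
  ⟨‖x‖⁻¹ • x, by
    rw [mem_sphere_zero_iff_norm, norm_smul, norm_inv, norm_norm,
      inv_mul_cancel₀ (norm_ne_zero_iff.mpr hx)]⟩

open Classical in
/-- The extension of a function on the sphere that is constant along rays, `x ↦ V (x / |x|)`
(with the irrelevant value `0` at the origin). -/
def radialExtension {N : ℕ} (V : Sphere N → ℝ) (x : Space N) : ℝ :=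
  if hx : x ≠ 0 then V (direction x hx) else 0

/-- The tangent space `T_σ 𝕊^{N-1}`, i.e. the orthogonal complement of `σ`, with the inner product
induced from `ℝ^N`. -/
abbrev Tangent {N : ℕ} (σ : Sphere N) : Submodule ℝ (Space N) := (ℝ ∙ (σ : Space N))ᗮ

theorem inner_tangent {N : ℕ} (σ : Sphere N) (w : Tangent σ) :
    inner ℝ (σ : Space N) (w : Space N) = 0 :=
  Submodule.mem_orthogonal_singleton_iff_inner_right.mp w.2

theorem norm_greatCircle {N : ℕ} (σ : Sphere N) (w : Tangent σ) (hw : ‖w‖ = 1) (t : ℝ) :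
    ‖Real.cos t • (σ : Space N) + Real.sin t • (w : Space N)‖ = 1 := by
  have h1 : ‖(σ : Space N)‖ = 1 := mem_sphere_zero_iff_norm.mp σ.2
  have h2 : ‖(w : Space N)‖ = 1 := hw
  have h : ‖Real.cos t • (σ : Space N) + Real.sin t • (w : Space N)‖ ^ 2 = 1 := by
    rw [norm_add_sq_real, norm_smul, norm_smul, inner_smul_left, inner_smul_right,
      inner_tangent, h1, h2]
    simp
  exact (pow_eq_one_iff_of_nonneg (norm_nonneg _) two_ne_zero).mp h

/-- The unit-speed geodesic of `𝕊^{N-1}` starting at `σ` with the unit velocity `w`. -/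
def greatCircle {N : ℕ} (σ : Sphere N) (w : Tangent σ) (hw : ‖w‖ = 1) (t : ℝ) : Sphere N :=
  ⟨Real.cos t • (σ : Space N) + Real.sin t • (w : Space N),
    mem_sphere_zero_iff_norm.mpr (norm_greatCircle σ w hw t)⟩

/-- The Laplace–Beltrami operator of the round unit sphere `𝕊^{N-1}` on `C²` functions: the trace
of the Riemannian Hessian, that is, the sum of the second derivatives of `V` along the unit-speed
geodesics in the directions of an orthonormal basis of the tangent space. -/
def sphereLaplacian {N : ℕ} (V : Sphere N → ℝ) (σ : Sphere N) : ℝ :=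
  ∑ i, iteratedDeriv 2 (fun t : ℝ => V (greatCircle σ (stdOrthonormalBasis ℝ (Tangent σ) i)
    ((stdOrthonormalBasis ℝ (Tangent σ)).orthonormal.1 i) t)) 0

theorem iteratedDeriv_two_comp_curve {N : ℕ} {F : Space N → ℝ} {c c' : ℝ → Space N}
    {a : Space N} (hF : ContDiffAt ℝ 2 F (c 0)) (hc : ∀ t, HasDerivAt c (c' t) t)
    (hc' : HasDerivAt c' a 0) :
    iteratedDeriv 2 (fun t => F (c t)) 0 =
      fderiv ℝ (fderiv ℝ F) (c 0) (c' 0) (c' 0) + fderiv ℝ F (c 0) a := by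
  have hev : ∀ᶠ t in 𝓝 (0 : ℝ), ContDiffAt ℝ 2 F (c t) :=
    (hc 0).continuousAt.eventually (hF.eventually (by simp))
  have h1 : deriv (fun t => F (c t)) =ᶠ[𝓝 0] fun t => fderiv ℝ F (c t) (c' t) := by
    filter_upwards [hev] with t ht
    exact ((ht.differentiableAt (by simp)).hasFDerivAt.comp_hasDerivAt t (hc t)).deriv
  have h2 : HasFDerivAt (fderiv ℝ F) (fderiv ℝ (fderiv ℝ F) (c 0)) (c 0) :=
    ((hF.fderiv_right (m := 1) (by norm_num)).differentiableAt (by simp)).hasFDerivAt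
  rw [iteratedDeriv_succ, iteratedDeriv_one, h1.deriv_eq]
  exact ((h2.comp_hasDerivAt (0 : ℝ) (hc 0)).clm_apply hc').deriv

theorem radialExtension_smul {N : ℕ} (V : Sphere N → ℝ) (σ : Sphere N) {r : ℝ}
    (hr : 0 < r) : radialExtension V (r • (σ : Space N)) = V σ := by
  have h1 : ‖(σ : Space N)‖ = 1 := mem_sphere_zero_iff_norm.mp σ.2
  have h0 : r • (σ : Space N) ≠ 0 := by
    rw [← norm_ne_zero_iff, norm_smul, h1]
    simpa using hr.ne'
  rw [radialExtension, dif_pos h0]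
  congr 1
  apply Subtype.ext
  simp only [direction, norm_smul, h1, smul_smul, Real.norm_eq_abs, abs_of_pos hr, mul_one,
    inv_mul_cancel₀ hr.ne', one_smul]

/-- The Laplace–Beltrami operator of the sphere is the Euclidean Laplacian of the extension that
is constant along rays. -/
theorem sphereLaplacian_eq_laplacian {N : ℕ} (V : Sphere N → ℝ) (σ : Sphere N)
    (hV : ContDiffAt ℝ 2 (radialExtension V) (σ : Space N)) :
    sphereLaplacian V σ = Laplacian.laplacian (radialExtension V) (σ : Space N) := by
  set F := radialExtension V with hFdef
  set b := stdOrthonormalBasis ℝ (Tangent σ) with hb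
  have hσ : ‖(σ : Space N)‖ = 1 := mem_sphere_zero_iff_norm.mp σ.2
  have hσ0 : (σ : Space N) ≠ 0 := by
    rw [← norm_ne_zero_iff, hσ]
    exact one_ne_zero
  -- along the ray through `σ`
  have hray : (fun t : ℝ => F (Real.exp t • (σ : Space N))) = fun _ => V σ := by
    funext t
    exact radialExtension_smul V σ (Real.exp_pos t)
  have hD1 : fderiv ℝ F (σ : Space N) (σ : Space N) = 0 := by
    have h := (hV.differentiableAt (by simp)).hasFDerivAt.comp_hasDerivAt_of_eq (0 : ℝ)
      ((Real.hasDerivAt_exp 0).smul_const (σ : Space N)) (by simp)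
    have h' : HasDerivAt (fun t : ℝ => F (Real.exp t • (σ : Space N))) 0 0 := by
      rw [hray]
      exact hasDerivAt_const _ _
    simpa using h.unique h'
  have hD2 : fderiv ℝ (fderiv ℝ F) (σ : Space N) (σ : Space N) (σ : Space N) = 0 := by
    have h := iteratedDeriv_two_comp_curve (F := F)
      (c := fun t : ℝ => Real.exp t • (σ : Space N))
      (c' := fun t : ℝ => Real.exp t • (σ : Space N)) (a := Real.exp 0 • (σ : Space N))
      (by simpa using hV) (fun t => (Real.hasDerivAt_exp t).smul_const _)
      ((Real.hasDerivAt_exp 0).smul_const _)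
    rw [hray] at h
    simpa [hD1, iteratedDeriv_const] using h.symm
  -- along great circles
  have hgc : ∀ i, iteratedDeriv 2 (fun t : ℝ => V (greatCircle σ (b i) (b.orthonormal.1 i) t)) 0 =
      fderiv ℝ (fderiv ℝ F) (σ : Space N) (b i : Space N) (b i : Space N) := by
    intro i
    have he : (fun t : ℝ => V (greatCircle σ (b i) (b.orthonormal.1 i) t)) =
        fun t => F (Real.cos t • (σ : Space N) + Real.sin t • (b i : Space N)) := by
      funext t
      have := radialExtension_smul V (greatCircle σ (b i) (b.orthonormal.1 i) t) one_pos
      rw [one_smul] at this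
      exact this.symm
    have h := iteratedDeriv_two_comp_curve (F := F)
      (c := fun t : ℝ => Real.cos t • (σ : Space N) + Real.sin t • (b i : Space N))
      (c' := fun t : ℝ => (-Real.sin t) • (σ : Space N) + Real.cos t • (b i : Space N))
      (a := (-Real.cos 0) • (σ : Space N) + (-Real.sin 0) • (b i : Space N))
      (by simpa using hV)
      (fun t => ((Real.hasDerivAt_cos t).smul_const _).add ((Real.hasDerivAt_sin t).smul_const _))
      (((Real.hasDerivAt_sin 0).neg.smul_const _).add ((Real.hasDerivAt_cos 0).smul_const _))
    rw [he, h]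
    simp [hD1]
  -- an orthonormal basis of `ℝ^N` containing `σ`
  have hon : Orthonormal ℝ (fun o : Option (Fin (Module.finrank ℝ (Tangent σ))) =>
      o.elim (σ : Space N) (fun i => (b i : Space N))) := by
    constructor
    · rintro (_ | i)
      · exact hσ
      · exact b.orthonormal.1 i
    · rintro (_ | i) (_ | j) hij
      · exact absurd rfl hij
      · exact inner_tangent σ (b j)
      · rw [real_inner_comm]
        exact inner_tangent σ (b i)
      · exact b.orthonormal.2 (fun h => hij (by rw [h]))
  have hcard : Fintype.card (Option (Fin (Module.finrank ℝ (Tangent σ)))) =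
      Module.finrank ℝ (Space N) := by
    have h := (ℝ ∙ (σ : Space N)).finrank_add_finrank_orthogonal
    rw [finrank_span_singleton hσ0] at h
    rw [Fintype.card_option, Fintype.card_fin, ← h, add_comm]
  let B : OrthonormalBasis (Option (Fin (Module.finrank ℝ (Tangent σ)))) ℝ (Space N) :=
    OrthonormalBasis.mk hon
      (by
        rw [← coe_basisOfOrthonormalOfCardEqFinrank hon hcard]
        exact (Module.Basis.span_eq _).ge)
  rw [sphereLaplacian, Finset.sum_congr rfl (fun i _ => hgc i),
    InnerProductSpace.laplacian_eq_iteratedFDeriv_orthonormalBasis F B]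
  beta_reduce
  rw [Fintype.sum_option]
  simp [B, iteratedFDeriv_two_apply, hD2]

/-- The Joseph–Lundgren exponent `p_JL(M)`, an extended real number. -/
def pJL (M : ℕ) : EReal :=
  if 11 ≤ M then ((1 + 4 / ((M : ℝ) - 4 - 2 * √((M : ℝ) - 1)) : ℝ) : EReal) else ⊤

/-- `μ = 2/(p-1) * (N - 2 - 2/(p-1))`. -/
def mu (N : ℕ) (p : ℝ) : ℝ := 2 / (p - 1) * ((N : ℝ) - 2 - 2 / (p - 1))

/-- `V` is a positive classical solution of `Δ_{𝕊^{N-1}} V - μ V + V^p = 0` on `𝕊^{N-1}`. -/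
structure IsPositiveSphereSolution (N : ℕ) [NeZero N] (p : ℝ) (V : Sphere N → ℝ) : Prop where
  contMDiff : ContMDiff (𝓡 (N - 1)) 𝓘(ℝ, ℝ) 2 V
  pos : ∀ σ, 0 < V σ
  equation : ∀ σ, sphereLaplacian V σ - mu N p * V σ + V σ ^ p = 0

/-- `V` is axially symmetric about the axis through the pole `e`: it depends only on the geodesic
distance `θ ∈ [0, π]` from `e`. -/
def IsAxiallySymmetric {N : ℕ} (e : Sphere N) (V : Sphere N → ℝ) : Prop :=
  ∃ v : ℝ → ℝ, ∀ σ : Sphere N, V σ = v (InnerProductGeometry.angle (e : Space N) (σ : Space N))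

/-- `U` is a positive classical solution of `ΔU + U^p = 0` in `ℝ^N ∖ {0}`
(nothing is asked of the value `U 0`). -/
structure IsPositiveLaneEmdenSolution (N : ℕ) (p : ℝ) (U : Space N → ℝ) : Prop where
  contDiffOn : ContDiffOn ℝ 2 U {0}ᶜ
  pos : ∀ x, x ≠ 0 → 0 < U x
  equation : ∀ x, x ≠ 0 → Laplacian.laplacian U x + U x ^ p = 0

/-- `U`, as a function on `ℝ^N ∖ {0}`, is radial. -/
def IsRadial {N : ℕ} (U : Space N → ℝ) : Prop :=
  ∃ f : ℝ → ℝ, ∀ x, x ≠ 0 → U x = f ‖x‖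

/-- The positive function `U` is singular at the origin: it blows up there. -/
def IsSingular {N : ℕ} (U : Space N → ℝ) : Prop :=
  Tendsto U (𝓝[≠] 0) atTop

/-- `U` has the form `U(R, σ) = R^{-2/(p-1)} V(σ)` in polar coordinates. -/
def IsSeparated {N : ℕ} (p : ℝ) (V : Sphere N → ℝ) (U : Space N → ℝ) : Prop :=
  ∀ x (hx : x ≠ 0), U x = ‖x‖ ^ (-(2 / (p - 1))) * V (direction x hx)

end

end SingularLaneEmden

/-!
Write `n = N - 1`, `m = 2 / (p - 1)`, `a = n - 2 - 2 m`, `B = m (a + m)`. A function of the angle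
`θ` from the pole is written as `g z` with `z = 1 - cos θ`; the equation on the sphere becomes
`z (2 - z) g'' + n (1 - z) g' = μ g - g ^ p`, singular at the pole `z = 0`. It suffices to find
regular solutions that are positive on the closed upper hemisphere `0 ≤ z ≤ 1` and satisfy
`g' = 0` at the equator `z = 1`, since they extend evenly across it, and to find them with
arbitrarily large `g 0`.

For a suitable truncation of the nonlinearity the regular solution with `g 0 = α` exists for every
`α` and depends continuously on it (`exists_singular_ivp`, a contraction argument). Because of the
special value of `μ`, the function `sin θ ^ (-m)` is, up to a factor, a singular solution which is
even about the equator. Dividing by it and using the time `t = log tan (θ / 2)`, the function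
`y = sin θ ^ m g` satisfies `y'' + a c(t) y' - B y + y ^ p = 0` with `c = cos θ = -tanh t`
(`hasDerivAt_emdenVelocity`). On the upper hemisphere `t ≤ 0` this is a damped oscillator around
the equilibrium `B ^ (1 / (p - 1))`: the damping `a c` is nonnegative because `p` is supercritical
on the sphere, and the equator condition is `y' = 0` at `t = 0`.

The energy is nonincreasing, and it is at most a fixed `-η` at the time `t₁` when `z` is of the
order `α ^ (1 - p)` (`emdenOrbit_of_regular`); this already gives positivity and uniform bounds. The
phase of `(y - B ^ (1 / (p - 1)), y')` is then controlled (`exists_phase_bounds`): a Lyapunov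
function shows that the orbit is away from the equilibrium only for a bounded time, and near the
equilibrium it rotates at a definite rate, because `p < p_JL(N - 1)` amounts to
`a ^ 2 < 4 (p - 1) B` (`exponent_range`). Since `t₁ → -∞` as `α → ∞`, the
phase at the equator is continuous in `α` and unbounded, so it equals a multiple of `π`, that is
`y' = 0`, for arbitrarily large `α` (`exists_hemisphere_solution`).

Finally `|x| ^ (-m) V (x / |x|)` solves the Lane–Emden equation by a computation of the Laplacian
along lines (`laplacian_separatedField`), and it is nonradial when the value of `V` at the pole
exceeds the only possible constant value `μ ^ (1 / (p - 1))`.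
-/

namespace SingularLaneEmden

/-! ### The singular initial value problem -/

/-- The projection of `ℝ` onto the interval `[-1, 3/2]` on which the singular initial value
problem is solved. -/
noncomputable def clampBase (z : ℝ) : ℝ := max (-1) (min z (3 / 2))

/-- The projection of `ℝ` onto `[0, 1]`. -/
noncomputable def clampUnit (r : ℝ) : ℝ := max 0 (min r 1)

@[fun_prop]
theorem continuous_clampBase : Continuous clampBase := by
  unfold clampBase; fun_prop

@[fun_prop]
theorem continuous_clampUnit : Continuous clampUnit := by
  unfold clampUnit; fun_prop

theorem clampBase_mem (z : ℝ) : clampBase z ∈ Icc (-1 : ℝ) (3 / 2) :=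
  ⟨le_max_left _ _, max_le (by norm_num) (min_le_right _ _)⟩

theorem clampUnit_mem (r : ℝ) : clampUnit r ∈ Icc (0 : ℝ) 1 :=
  ⟨le_max_left _ _, max_le (by norm_num) (min_le_right _ _)⟩

theorem clampBase_of_mem {z : ℝ} (hz : z ∈ Icc (-1 : ℝ) (3 / 2)) : clampBase z = z := by
  rw [clampBase, min_eq_left hz.2, max_eq_right hz.1]

theorem clampUnit_of_mem {r : ℝ} (hr : r ∈ Icc (0 : ℝ) 1) : clampUnit r = r := by
  rw [clampUnit, min_eq_left hr.2, max_eq_right hr.1]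

theorem mul_mem_base {z r : ℝ} (hz : z ∈ Icc (-1 : ℝ) (3 / 2)) (hr : r ∈ Icc (0 : ℝ) 1) :
    z * r ∈ Icc (-1 : ℝ) (3 / 2) := by
  obtain ⟨h1, h2⟩ := hz
  obtain ⟨h3, h4⟩ := hr
  constructor <;> nlinarith

/-- The kernel that inverts `h ↦ z (2 - z) h' + 2 ν (1 - z) h` among functions regular at
`z = 0`, after rescaling the interval `[0, z]` to `[0, 1]`. -/
noncomputable def slopeKernel (ν z r : ℝ) : ℝ :=
  r ^ (ν - 1) * (2 - z * r) ^ (ν - 1) * (2 - z) ^ (-ν)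

/-- The derivative of `slopeKernel` in `z`. -/
noncomputable def slopeKernelDeriv (ν z r : ℝ) : ℝ :=
  r ^ (ν - 1) * (-r * (ν - 1) * (2 - z * r) ^ (ν - 1 - 1)) * (2 - z) ^ (-ν) +
    r ^ (ν - 1) * (2 - z * r) ^ (ν - 1) * (-1 * -ν * (2 - z) ^ (-ν - 1))

theorem two_sub_pos {z : ℝ} (hz : z ∈ Icc (-1 : ℝ) (3 / 2)) : 0 < 2 - z := by
  linarith [hz.2]

theorem hasDerivAt_slopeKernel (ν : ℝ) {z r : ℝ} (hz : z ∈ Icc (-1 : ℝ) (3 / 2))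
    (hr : r ∈ Icc (0 : ℝ) 1) :
    HasDerivAt (fun z => slopeKernel ν z r) (slopeKernelDeriv ν z r) z := by
  have h1 : HasDerivAt (fun z : ℝ => 2 - z * r) (-r) z := by
    simpa using ((hasDerivAt_id z).mul_const r).const_sub 2
  have h2 : HasDerivAt (fun z : ℝ => 2 - z) (-1) z := by
    simpa using (hasDerivAt_id z).const_sub 2
  have h3 := h1.rpow_const (p := ν - 1) (Or.inl (two_sub_pos (mul_mem_base hz hr)).ne')
  have h4 := h2.rpow_const (p := -ν) (Or.inl (two_sub_pos hz).ne')
  have h5 := (h3.const_mul (r ^ (ν - 1))).mul h4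
  exact h5

theorem continuous_slopeKernel {ν : ℝ} (hν : 1 ≤ ν) :
    Continuous fun q : ℝ × ℝ => slopeKernel ν (clampBase q.1) q.2 := by
  have h0 : 0 ≤ ν - 1 := by linarith
  unfold slopeKernel
  refine Continuous.mul (Continuous.mul ?_ ?_) ?_
  · exact continuous_snd.rpow_const fun _ => Or.inr h0
  · exact Continuous.rpow_const (by fun_prop) fun _ => Or.inr h0
  · exact Continuous.rpow_const (by fun_prop) fun q =>
      Or.inl (two_sub_pos (clampBase_mem q.1)).ne'

theorem continuous_slopeKernelDeriv {ν : ℝ} (hν : 1 ≤ ν) :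
    Continuous fun q : ℝ × ℝ => slopeKernelDeriv ν (clampBase q.1) (clampUnit q.2) := by
  have h0 : 0 ≤ ν - 1 := by linarith
  have h1 : Continuous fun q : ℝ × ℝ => clampUnit q.2 ^ (ν - 1) :=
    Continuous.rpow_const (by fun_prop) fun _ => Or.inr h0
  have h2 : ∀ s : ℝ, Continuous fun q : ℝ × ℝ => (2 - clampBase q.1 * clampUnit q.2) ^ s :=
    fun s => Continuous.rpow_const (by fun_prop) fun q =>
      Or.inl (two_sub_pos (mul_mem_base (clampBase_mem q.1) (clampUnit_mem q.2))).ne'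
  have h3 : ∀ s : ℝ, Continuous fun q : ℝ × ℝ => (2 - clampBase q.1) ^ s :=
    fun s => Continuous.rpow_const (by fun_prop) fun q =>
      Or.inl (two_sub_pos (clampBase_mem q.1)).ne'
  unfold slopeKernelDeriv
  have h4 := h2 (ν - 1 - 1)
  have h5 := h2 (ν - 1)
  have h6 := h3 (-ν)
  have h7 := h3 (-ν - 1)
  fun_prop

theorem exists_slopeKernel_bound {ν : ℝ} (hν : 1 ≤ ν) :
    ∃ C : ℝ, 0 < C ∧ ∀ z ∈ Icc (-1 : ℝ) (3 / 2), ∀ r ∈ Icc (0 : ℝ) 1, |slopeKernel ν z r| ≤ C := by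
  obtain ⟨C, hC⟩ := (isCompact_Icc.prod isCompact_Icc :
    IsCompact (Icc (-1 : ℝ) (3 / 2) ×ˢ Icc (0 : ℝ) 1)).exists_bound_of_continuousOn
    (continuous_slopeKernel hν).continuousOn
  refine ⟨max C 1, by positivity, fun z hz r hr => ?_⟩
  have := hC (z, r) ⟨hz, hr⟩
  simp only [clampBase_of_mem hz, Real.norm_eq_abs] at this
  exact this.trans (le_max_left _ _)

/-- The solution `h`, regular at `z = 0`, of `z (2 - z) h' + 2 ν (1 - z) h = F (w z)`; outside
`[-1, 3/2]` it is extended by constants. -/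
noncomputable def regularSlope (ν : ℝ) (F w : ℝ → ℝ) (z : ℝ) : ℝ :=
  ∫ r in (0 : ℝ)..1, slopeKernel ν (clampBase z) r * F (w (clampBase z * r))

theorem continuous_regularSlope_param {X : Type*} [TopologicalSpace X] {ν : ℝ} (hν : 1 ≤ ν)
    {F : ℝ → ℝ} (hF : Continuous F) {w : X → ℝ → ℝ}
    (hw : Continuous fun q : X × ℝ => w q.1 q.2) :
    Continuous fun q : X × ℝ => regularSlope ν F (w q.1) q.2 := by
  unfold regularSlope
  refine intervalIntegral.continuous_parametric_intervalIntegral_of_continuous' ?_ 0 1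
  have h1 : Continuous fun q : (X × ℝ) × ℝ => slopeKernel ν (clampBase q.1.2) q.2 :=
    (continuous_slopeKernel hν).comp (by fun_prop : Continuous fun q : (X × ℝ) × ℝ => (q.1.2, q.2))
  have h2 : Continuous fun q : (X × ℝ) × ℝ => w q.1.1 (clampBase q.1.2 * q.2) :=
    hw.comp (by fun_prop : Continuous fun q : (X × ℝ) × ℝ => (q.1.1, clampBase q.1.2 * q.2))
  exact h1.mul (hF.comp h2)

theorem continuous_regularSlope {ν : ℝ} (hν : 1 ≤ ν)
    {F : ℝ → ℝ} (hF : Continuous F) {w : ℝ → ℝ} (hw : Continuous w) :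
    Continuous (regularSlope ν F w) := by
  have h : Continuous fun q : Unit × ℝ => regularSlope ν F w q.2 :=
    continuous_regularSlope_param (w := fun _ : Unit => w) hν hF (hw.comp continuous_snd)
  have h' := h.comp (by fun_prop : Continuous fun z : ℝ => ((), z))
  simpa only [Function.comp_def] using h'

theorem regularSlope_congr {ν : ℝ} {F w₁ w₂ : ℝ → ℝ}
    (h : ∀ z ∈ Icc (-1 : ℝ) (3 / 2), w₁ z = w₂ z) : regularSlope ν F w₁ = regularSlope ν F w₂ := by
  funext z
  refine intervalIntegral.integral_congr fun r hr => ?_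
  rw [uIcc_of_le zero_le_one] at hr
  simp only [h _ (mul_mem_base (clampBase_mem z) hr)]

theorem abs_regularSlope_sub_le {ν C K δ : ℝ} {L : NNReal} (hν : 1 ≤ ν) (hK : 0 ≤ K) (hδ : 0 ≤ δ)
    (hC : ∀ z ∈ Icc (-1 : ℝ) (3 / 2), ∀ r ∈ Icc (0 : ℝ) 1, |slopeKernel ν z r| ≤ C)
    {F w₁ w₂ : ℝ → ℝ} (hF : LipschitzWith L F) (hw₁ : Continuous w₁) (hw₂ : Continuous w₂)
    (h : ∀ z ∈ Icc (-1 : ℝ) (3 / 2), |w₁ z - w₂ z| ≤ δ * Real.exp (K * |z|)) {z : ℝ}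
    (hz : z ∈ Icc (-1 : ℝ) (3 / 2)) :
    |regularSlope ν F w₁ z - regularSlope ν F w₂ z| ≤ C * L * δ * Real.exp (K * |z|) := by
  have hcont : ∀ w : ℝ → ℝ, Continuous w → Continuous fun r : ℝ =>
      slopeKernel ν (clampBase z) r * F (w (clampBase z * r)) := fun w hw =>
    ((continuous_slopeKernel hν).comp (by fun_prop : Continuous fun r : ℝ => (z, r))).mul
      (hF.continuous.comp (hw.comp (by fun_prop)))
  unfold regularSlope
  rw [← intervalIntegral.integral_sub ((hcont w₁ hw₁).intervalIntegrable _ _)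
    ((hcont w₂ hw₂).intervalIntegrable _ _)]
  have hb : ∀ r ∈ uIoc (0 : ℝ) 1, ‖slopeKernel ν (clampBase z) r * F (w₁ (clampBase z * r)) -
      slopeKernel ν (clampBase z) r * F (w₂ (clampBase z * r))‖ ≤
      C * L * δ * Real.exp (K * |z|) := by
    intro r hr
    rw [uIoc_of_le zero_le_one] at hr
    have hr' : r ∈ Icc (0 : ℝ) 1 := ⟨hr.1.le, hr.2⟩
    rw [clampBase_of_mem hz, ← mul_sub, norm_mul, Real.norm_eq_abs, Real.norm_eq_abs]
    have h1 := hC z hz r hr'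
    have h2 : |F (w₁ (z * r)) - F (w₂ (z * r))| ≤ L * |w₁ (z * r) - w₂ (z * r)| := by
      have := hF.dist_le_mul (w₁ (z * r)) (w₂ (z * r))
      rwa [Real.dist_eq, Real.dist_eq] at this
    have h3 := h _ (mul_mem_base hz hr')
    have h4 : Real.exp (K * |z * r|) ≤ Real.exp (K * |z|) := by
      apply Real.exp_le_exp.mpr
      rw [abs_mul, abs_of_nonneg hr'.1]
      have := mul_le_of_le_one_right (abs_nonneg z) hr'.2
      exact mul_le_mul_of_nonneg_left this hK
    have hC0 : 0 ≤ C := (abs_nonneg _).trans h1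
    calc |slopeKernel ν z r| * |F (w₁ (z * r)) - F (w₂ (z * r))|
        ≤ C * (L * (δ * Real.exp (K * |z|))) := by
          refine mul_le_mul h1 (h2.trans ?_) (abs_nonneg _) hC0
          exact mul_le_mul_of_nonneg_left
            (h3.trans (mul_le_mul_of_nonneg_left h4 hδ)) L.coe_nonneg
      _ = _ := by ring
  have := intervalIntegral.norm_integral_le_of_norm_le_const hb
  simpa using this

/-- Integration gains a factor `1 / K` in the weight `exp (K |z|)`; this makes the Picard operator a
contraction for large `K`. -/
theorem abs_integral_le_exp {f : ℝ → ℝ} {C K z : ℝ} (hC : 0 ≤ C) (hK : 0 < K)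
    (h : ∀ r ∈ Icc (0 : ℝ) 1, |f (z * r)| ≤ C * Real.exp (K * |z * r|)) :
    |∫ x in (0 : ℝ)..z, f x| ≤ C / K * Real.exp (K * |z|) := by
  have h1 : ∫ x in (0 : ℝ)..z, f x = ∫ r in (0 : ℝ)..1, z * f (z * r) := by
    have := intervalIntegral.mul_integral_comp_mul_left (a := 0) (b := 1) (f := f) z
    rw [intervalIntegral.integral_const_mul, this, mul_zero, mul_one]
  have h2 : ∫ r in (0 : ℝ)..1, |z| * (C * Real.exp (K * |z| * r)) =
      C / K * Real.exp (K * |z| * 1) - C / K * Real.exp (K * |z| * 0) := by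
    refine intervalIntegral.integral_eq_sub_of_hasDerivAt (f := fun r : ℝ =>
      C / K * Real.exp (K * |z| * r)) (fun r _ => ?_)
      (by apply Continuous.intervalIntegrable; fun_prop)
    have := (((hasDerivAt_id r).const_mul (K * |z|)).exp).const_mul (C / K)
    refine this.congr_deriv ?_
    simp only [id, mul_one]
    field_simp
  have h3 : ‖∫ r in (0 : ℝ)..1, z * f (z * r)‖ ≤
      ∫ r in (0 : ℝ)..1, |z| * (C * Real.exp (K * |z| * r)) := by
    refine intervalIntegral.norm_integral_le_of_norm_le zero_le_one ?_
      (by apply Continuous.intervalIntegrable; fun_prop)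
    refine Eventually.of_forall fun r hr => ?_
    have hr' : r ∈ Icc (0 : ℝ) 1 := ⟨hr.1.le, hr.2⟩
    rw [norm_mul, Real.norm_eq_abs, Real.norm_eq_abs]
    have := h r hr'
    rw [abs_mul, abs_of_nonneg hr'.1, ← mul_assoc] at this
    exact mul_le_mul_of_nonneg_left this (abs_nonneg _)
  rw [h1, ← Real.norm_eq_abs]
  refine h3.trans ?_
  rw [h2, mul_one]
  have : 0 ≤ C / K * Real.exp (K * |z| * 0) := by positivity
  linarith

/-- The function `z ↦ exp (K |z|) u z` represented by `u` in the weighted space in which the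
integral equation is a contraction; `u` is extended by constants outside `[-1, 3/2]`. -/
noncomputable def unweight (K : ℝ) (u : C(Icc (-1 : ℝ) (3 / 2), ℝ)) (z : ℝ) : ℝ :=
  Real.exp (K * |z|) * IccExtend (by norm_num) u z

theorem continuous_unweight (K : ℝ) :
    Continuous fun q : C(Icc (-1 : ℝ) (3 / 2), ℝ) × ℝ => unweight K q.1 q.2 := by
  unfold unweight IccExtend
  simp only [Function.comp_apply]
  have h : Continuous fun q : C(Icc (-1 : ℝ) (3 / 2), ℝ) × ℝ =>
      q.1 (projIcc (-1 : ℝ) (3 / 2) (by norm_num) q.2) := by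
    have := continuous_projIcc (a := (-1 : ℝ)) (b := 3 / 2) (h := by norm_num)
    fun_prop
  fun_prop

theorem continuous_unweight_right (K : ℝ) (u : C(Icc (-1 : ℝ) (3 / 2), ℝ)) :
    Continuous (unweight K u) :=
  (continuous_unweight K).comp (by fun_prop : Continuous fun z : ℝ => (u, z))

theorem unweight_of_mem (K : ℝ) (u : C(Icc (-1 : ℝ) (3 / 2), ℝ)) {z : ℝ}
    (hz : z ∈ Icc (-1 : ℝ) (3 / 2)) : unweight K u z = Real.exp (K * |z|) * u ⟨z, hz⟩ := by
  rw [unweight, IccExtend_of_mem _ _ hz]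

/-- The Picard operator of the singular initial value problem, in the weighted space. -/
noncomputable def picardMap (ν : ℝ) (hν : 1 ≤ ν) (F : ℝ → ℝ) (hF : Continuous F) (K α : ℝ)
    (u : C(Icc (-1 : ℝ) (3 / 2), ℝ)) : C(Icc (-1 : ℝ) (3 / 2), ℝ) where
  toFun z := Real.exp (-(K * |(z : ℝ)|)) *
    (α + ∫ x in (0 : ℝ)..z, regularSlope ν F (unweight K u) x)
  continuous_toFun := by
    have h1 : Continuous fun z : ℝ => ∫ x in (0 : ℝ)..z, regularSlope ν F (unweight K u) x :=
      intervalIntegral.continuous_primitive (fun a b =>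
        (continuous_regularSlope hν hF (continuous_unweight_right K u)).intervalIntegrable a b) 0
    fun_prop

/-- Solutions `g α` of `z (2 - z) g'' + 2 ν (1 - z) g' = F g`, regular at the singular point `z = 0`
with `g α 0 = α`, jointly continuous in `α` and `z`. The equation is expressed by the formula for
the derivative; see `regularSlope_ode`. -/
theorem exists_singular_ivp {ν : ℝ} (hν : 1 ≤ ν) {F : ℝ → ℝ} {L : NNReal}
    (hF : LipschitzWith L F) :
    ∃ g : ℝ → ℝ → ℝ, Continuous (fun q : ℝ × ℝ => g q.1 q.2) ∧ (∀ α, g α 0 = α) ∧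
      ∀ α z, HasDerivAt (g α) (regularSlope ν F (g α) z) z := by
  obtain ⟨C, hC0, hC⟩ := exists_slopeKernel_bound hν
  -- with this weight the Picard operator contracts by the factor `1 / 2`
  set K : ℝ := 2 * (C * L + 1) with hK
  have hK0 : 0 < K := by positivity
  set T := picardMap ν hν F hF.continuous K with hT
  have hdist : ∀ u₁ u₂ : C(Icc (-1 : ℝ) (3 / 2), ℝ), ∀ z ∈ Icc (-1 : ℝ) (3 / 2),
      |unweight K u₁ z - unweight K u₂ z| ≤ dist u₁ u₂ * Real.exp (K * |z|) := by
    intro u₁ u₂ z hz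
    rw [unweight_of_mem K _ hz, unweight_of_mem K _ hz, ← mul_sub, abs_mul, Real.abs_exp, mul_comm,
      ← Real.dist_eq]
    exact mul_le_mul_of_nonneg_right (ContinuousMap.dist_apply_le_dist _) (Real.exp_pos _).le
  have hcontr : ∀ α, ContractingWith (1 / 2) (T α) := by
    intro α
    refine ⟨by norm_num, LipschitzWith.of_dist_le_mul fun u₁ u₂ => ?_⟩
    rw [ContinuousMap.dist_le (by positivity)]
    rintro ⟨z, hz⟩
    have h1 := abs_integral_le_exp (f := fun x => regularSlope ν F (unweight K u₁) x -
      regularSlope ν F (unweight K u₂) x) (C := C * L * dist u₁ u₂) (K := K) (z := z)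
      (by positivity) hK0 (fun r hr => abs_regularSlope_sub_le hν hK0.le dist_nonneg hC hF
        (continuous_unweight_right K u₁) (continuous_unweight_right K u₂) (hdist u₁ u₂)
        (mul_mem_base hz hr))
    rw [intervalIntegral.integral_sub
      ((continuous_regularSlope hν hF.continuous
        (continuous_unweight_right K u₁)).intervalIntegrable _ _)
      ((continuous_regularSlope hν hF.continuous
        (continuous_unweight_right K u₂)).intervalIntegrable _ _)] at h1
    have h2 : dist (T α u₁ ⟨z, hz⟩) (T α u₂ ⟨z, hz⟩) = Real.exp (-(K * |z|)) *
        |(∫ x in (0 : ℝ)..z, regularSlope ν F (unweight K u₁) x) -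
          ∫ x in (0 : ℝ)..z, regularSlope ν F (unweight K u₂) x| := by
      rw [Real.dist_eq, ← Real.abs_exp (-(K * |z|)), ← abs_mul]
      congr 1
      simp only [hT, picardMap, ContinuousMap.coe_mk]
      ring
    rw [h2]
    calc _ ≤ Real.exp (-(K * |z|)) * (C * L * dist u₁ u₂ / K * Real.exp (K * |z|)) :=
          mul_le_mul_of_nonneg_left h1 (Real.exp_pos _).le
      _ = C * L / K * dist u₁ u₂ := by
          rw [Real.exp_neg]
          field_simp
      _ ≤ 1 / 2 * dist u₁ u₂ := by
          refine mul_le_mul_of_nonneg_right ?_ dist_nonneg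
          rw [div_le_iff₀ hK0, hK]
          linarith
      _ = _ := by simp
  set U : ℝ → C(Icc (-1 : ℝ) (3 / 2), ℝ) := fun α => (hcontr α).fixedPoint with hU
  have hUfix : ∀ α, T α (U α) = U α := fun α => (hcontr α).fixedPoint_isFixedPt
  have hUcont : Continuous U := by
    refine (LipschitzWith.of_dist_le_mul (K := 2) fun α₁ α₂ => ?_).continuous
    have := ContractingWith.fixedPoint_lipschitz_in_map (hcontr α₁) (hcontr α₂)
      (C := dist α₁ α₂) (fun u => by
        rw [ContinuousMap.dist_le dist_nonneg]
        rintro ⟨z, hz⟩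
        have h2 : dist (T α₁ u ⟨z, hz⟩) (T α₂ u ⟨z, hz⟩) =
            Real.exp (-(K * |z|)) * |α₁ - α₂| := by
          rw [Real.dist_eq, ← Real.abs_exp (-(K * |z|)), ← abs_mul]
          congr 1
          simp only [hT, picardMap, ContinuousMap.coe_mk]
          ring
        rw [h2, Real.dist_eq]
        refine mul_le_of_le_one_left (abs_nonneg _) (Real.exp_le_one_iff.mpr ?_)
        have : 0 ≤ K * |z| := by positivity
        linarith)
    refine this.trans (le_of_eq ?_)
    simp
    ring
  have hw : Continuous fun q : ℝ × ℝ => unweight K (U q.1) q.2 :=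
    (continuous_unweight K).comp
      ((hUcont.comp continuous_fst).prodMk continuous_snd)
  have hs := continuous_regularSlope_param (w := fun α => unweight K (U α)) hν hF.continuous hw
  set g : ℝ → ℝ → ℝ := fun α z =>
    α + ∫ x in (0 : ℝ)..z, regularSlope ν F (unweight K (U α)) x with hg
  have hgw : ∀ α, ∀ z ∈ Icc (-1 : ℝ) (3 / 2), g α z = unweight K (U α) z := by
    intro α z hz
    rw [unweight_of_mem K _ hz, ← hUfix α]
    simp only [hT, picardMap, ContinuousMap.coe_mk]
    rw [← mul_assoc, ← Real.exp_add]
    simp [hg]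
  refine ⟨g, ?_, fun α => by simp [hg], fun α z => ?_⟩
  · refine continuous_fst.add ?_
    refine intervalIntegral.continuous_parametric_intervalIntegral_of_continuous
      (f := fun (q : ℝ × ℝ) x => regularSlope ν F (unweight K (U q.1)) x) ?_ continuous_snd
    have h' := hs.comp (by fun_prop : Continuous fun q : (ℝ × ℝ) × ℝ => (q.1.1, q.2))
    simpa only [Function.comp_def, Function.uncurry_def] using h'
  · rw [regularSlope_congr (hgw α)]
    have hc : Continuous (regularSlope ν F (unweight K (U α))) :=
      continuous_regularSlope hν hF.continuous (continuous_unweight_right K _)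
    exact (intervalIntegral.integral_hasDerivAt_right (hc.intervalIntegrable _ _)
      (hc.stronglyMeasurableAtFilter _ _) hc.continuousAt).const_add α

/-! ### Regularity and the differential equation -/

/-- The derivative of `regularSlope` along a continuously differentiable `g` with derivative
`regularSlope ν F g`, obtained by differentiating under the integral. -/
noncomputable def regularSlopeDeriv (ν : ℝ) (F g : ℝ → ℝ) (z : ℝ) : ℝ :=
  ∫ r in (0 : ℝ)..1,
    (slopeKernelDeriv ν (clampBase z) (clampUnit r) * F (g (clampBase z * r)) +
      slopeKernel ν (clampBase z) r *
        (deriv F (g (clampBase z * r)) * (regularSlope ν F g (clampBase z * r) * r)))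

theorem continuous_regularSlopeDeriv_integrand {ν : ℝ} (hν : 1 ≤ ν) {F : ℝ → ℝ}
    (hF : ContDiff ℝ 1 F) {g : ℝ → ℝ} (hg : Continuous g) :
    Continuous fun q : ℝ × ℝ =>
      slopeKernelDeriv ν (clampBase q.1) (clampUnit q.2) * F (g (clampBase q.1 * q.2)) +
      slopeKernel ν (clampBase q.1) q.2 *
        (deriv F (g (clampBase q.1 * q.2)) * (regularSlope ν F g (clampBase q.1 * q.2) * q.2)) := by
  have h1 := continuous_slopeKernelDeriv hν
  have h2 := continuous_slopeKernel hν
  have h3 := continuous_regularSlope hν hF.continuous hg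
  have h4 : Continuous (deriv F) := hF.continuous_deriv le_rfl
  have h5 := hF.continuous
  fun_prop

theorem continuous_regularSlopeDeriv {ν : ℝ} (hν : 1 ≤ ν) {F : ℝ → ℝ}
    (hF : ContDiff ℝ 1 F) {g : ℝ → ℝ} (hg : Continuous g) :
    Continuous (regularSlopeDeriv ν F g) := by
  unfold regularSlopeDeriv
  exact intervalIntegral.continuous_parametric_intervalIntegral_of_continuous'
    (continuous_regularSlopeDeriv_integrand hν hF hg) 0 1

theorem hasDerivAt_regularSlope {ν : ℝ} (hν : 1 ≤ ν) {F : ℝ → ℝ}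
    (hF : ContDiff ℝ 1 F) {g : ℝ → ℝ} (hg : ∀ z, HasDerivAt g (regularSlope ν F g z) z) {z : ℝ}
    (hz : z ∈ Ioo (-1 : ℝ) (3 / 2)) :
    HasDerivAt (regularSlope ν F g) (regularSlopeDeriv ν F g z) z := by
  have hgc : Continuous g := continuous_iff_continuousAt.mpr fun z => (hg z).continuousAt
  have hc := continuous_regularSlopeDeriv_integrand hν hF hgc
  obtain ⟨b, hb⟩ := (isCompact_Icc.prod isCompact_Icc :
    IsCompact (Icc (-1 : ℝ) (3 / 2) ×ˢ Icc (0 : ℝ) 1)).exists_bound_of_continuousOn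
    hc.continuousOn
  have hk := continuous_slopeKernel hν
  have hFc := hF.continuous
  have hq : ∀ x, Continuous fun r : ℝ =>
      slopeKernel ν (clampBase x) r * F (g (clampBase x * r)) := fun x =>
    (hk.comp (by fun_prop : Continuous fun r : ℝ => (x, r))).mul (by fun_prop)
  have := intervalIntegral.hasDerivAt_integral_of_dominated_loc_of_deriv_le
    (μ := MeasureTheory.volume) (a := 0) (b := 1) (x₀ := z)
    (F := fun x r => slopeKernel ν (clampBase x) r * F (g (clampBase x * r)))
    (F' := fun z r => slopeKernelDeriv ν (clampBase z) (clampUnit r) * F (g (clampBase z * r)) +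
      slopeKernel ν (clampBase z) r *
        (deriv F (g (clampBase z * r)) * (regularSlope ν F g (clampBase z * r) * r)))
    (bound := fun _ => b) (s := Ioo (-1 : ℝ) (3 / 2)) (Ioo_mem_nhds hz.1 hz.2)
    (Eventually.of_forall fun x => (hq x).aestronglyMeasurable)
    ((hq z).intervalIntegrable _ _)
    (hc.comp (by fun_prop : Continuous fun r : ℝ => (z, r))).aestronglyMeasurable
    (Eventually.of_forall fun r hr x hx => by
      rw [uIoc_of_le zero_le_one] at hr
      exact hb (x, r) ⟨Ioo_subset_Icc_self hx, ⟨hr.1.le, hr.2⟩⟩)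
    (by simp)
    (Eventually.of_forall fun r hr x hx => by
      rw [uIoc_of_le zero_le_one] at hr
      have hr' : r ∈ Icc (0 : ℝ) 1 := ⟨hr.1.le, hr.2⟩
      have hx' := Ioo_subset_Icc_self hx
      have h1 : HasDerivAt (fun x : ℝ => x * r) r x := by
        simpa using (hasDerivAt_id x).mul_const r
      have h2 : HasDerivAt (fun x => F (g (x * r)))
          (deriv F (g (x * r)) * (regularSlope ν F g (x * r) * r)) x :=
        ((hF.differentiable (by norm_num)) _).hasDerivAt.comp x ((hg (x * r)).comp x h1)
      have h3 := (hasDerivAt_slopeKernel ν hx' hr').mul h2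
      simp only [clampBase_of_mem hx', clampUnit_of_mem hr']
      refine h3.congr_of_eventuallyEq ?_
      filter_upwards [Ioo_mem_nhds hx.1 hx.2] with y hy
      simp [clampBase_of_mem (Ioo_subset_Icc_self hy)])
  exact this.2

/-- The weighted slope is the primitive of the weighted right-hand side. -/
theorem rpow_mul_regularSlope {ν : ℝ} {F g : ℝ → ℝ} {z : ℝ}
    (hz : z ∈ Ioo (0 : ℝ) (3 / 2)) :
    z ^ ν * (2 - z) ^ ν * regularSlope ν F g z =
      ∫ x in (0 : ℝ)..z, x ^ (ν - 1) * (2 - x) ^ (ν - 1) * F (g x) := by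
  have h1 := intervalIntegral.mul_integral_comp_mul_left (a := 0) (b := 1)
    (f := fun x => x ^ (ν - 1) * (2 - x) ^ (ν - 1) * F (g x)) z
  rw [mul_zero, mul_one] at h1
  rw [← h1, ← intervalIntegral.integral_const_mul, regularSlope,
    ← intervalIntegral.integral_const_mul]
  refine intervalIntegral.integral_congr fun r hr => ?_
  rw [uIcc_of_le zero_le_one] at hr
  have h2 : 0 < 2 - z := by linarith [hz.2]
  have h3 : z ^ ν = z * z ^ (ν - 1) := by
    rw [Real.rpow_sub_one hz.1.ne']
    field_simp [hz.1.ne']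
  have h4 : (2 - z) ^ ν * (2 - z) ^ (-ν) = 1 := by
    rw [← Real.rpow_add h2]
    simp
  simp only [slopeKernel, clampBase_of_mem (z := z) ⟨by linarith [hz.1], hz.2.le⟩]
  rw [Real.mul_rpow hz.1.le hr.1, h3]
  linear_combination (z * z ^ (ν - 1) * r ^ (ν - 1) * (2 - z * r) ^ (ν - 1) * F (g (z * r))) * h4

theorem regularSlope_ode {ν : ℝ} (hν : 1 ≤ ν) {F : ℝ → ℝ}
    (hF : ContDiff ℝ 1 F) {g : ℝ → ℝ} (hg : ∀ z, HasDerivAt g (regularSlope ν F g z) z) {z : ℝ}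
    (hz : z ∈ Ico (0 : ℝ) (3 / 2)) :
    z * (2 - z) * regularSlopeDeriv ν F g z + 2 * ν * (1 - z) * regularSlope ν F g z =
      F (g z) := by
  have hgc : Continuous g := continuous_iff_continuousAt.mpr fun z => (hg z).continuousAt
  have hpos : ∀ z ∈ Ioo (0 : ℝ) (3 / 2), z * (2 - z) * regularSlopeDeriv ν F g z +
      2 * ν * (1 - z) * regularSlope ν F g z = F (g z) := by
    intro z hz
    have h2 : 0 < 2 - z := by linarith [hz.2]
    have hFc := hF.continuous
    have hc : Continuous fun x : ℝ => x ^ (ν - 1) * (2 - x) ^ (ν - 1) * F (g x) := by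
      have h0 : 0 ≤ ν - 1 := by linarith
      refine Continuous.mul (Continuous.mul ?_ ?_) (by fun_prop)
      · exact continuous_id.rpow_const fun _ => Or.inr h0
      · exact Continuous.rpow_const (by fun_prop) fun _ => Or.inr h0
    have hR : HasDerivAt (fun z => ∫ x in (0 : ℝ)..z, x ^ (ν - 1) * (2 - x) ^ (ν - 1) * F (g x))
        (z ^ (ν - 1) * (2 - z) ^ (ν - 1) * F (g z)) z :=
      intervalIntegral.integral_hasDerivAt_right (hc.intervalIntegrable _ _)
        (hc.stronglyMeasurableAtFilter _ _) hc.continuousAt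
    have h3 : HasDerivAt (fun z : ℝ => 2 - z) (-1) z := by
      simpa using (hasDerivAt_id z).const_sub 2
    have hL := (((hasDerivAt_id z).rpow_const (p := ν) (Or.inl hz.1.ne')).mul
      (h3.rpow_const (p := ν) (Or.inl h2.ne'))).mul
      (hasDerivAt_regularSlope hν hF hg ⟨by linarith [hz.1], hz.2⟩)
    have hR' := hR.congr_of_eventuallyEq (f₁ := fun z => z ^ ν * (2 - z) ^ ν * regularSlope ν F g z)
      (by
        filter_upwards [Ioo_mem_nhds hz.1 hz.2] with x hx
        exact rpow_mul_regularSlope hx)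
    have h5 := hL.unique hR'
    simp only [id, Pi.mul_apply] at h5
    have h6 : z ^ ν = z * z ^ (ν - 1) := by
      rw [Real.rpow_sub_one hz.1.ne']
      field_simp [hz.1.ne']
    have h7 : (2 - z) ^ ν = (2 - z) * (2 - z) ^ (ν - 1) := by
      rw [Real.rpow_sub_one h2.ne']
      field_simp
    rw [h6, h7] at h5
    have h8 : z ^ (ν - 1) * (2 - z) ^ (ν - 1) ≠ 0 :=
      mul_ne_zero (Real.rpow_pos_of_pos hz.1 _).ne' (Real.rpow_pos_of_pos h2 _).ne'
    refine mul_left_cancel₀ h8 ?_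
    linear_combination h5
  -- at `z = 0` the equation follows from its validity on `(0, 3/2)` by continuity
  have hFc := hF.continuous
  have hs := continuous_regularSlope hν hFc hgc
  have hd := continuous_regularSlopeDeriv hν hF hgc
  have hcl : IsClosed {z : ℝ | z * (2 - z) * regularSlopeDeriv ν F g z +
      2 * ν * (1 - z) * regularSlope ν F g z = F (g z)} :=
    isClosed_eq (by fun_prop) (by fun_prop)
  have := hcl.closure_subset_iff.mpr hpos
  rw [closure_Ioo (by norm_num)] at this
  exact this ⟨hz.1, hz.2.le⟩

theorem slopeKernel_nonneg {ν z r : ℝ} (hz : z ∈ Icc (-1 : ℝ) (3 / 2)) (hr : r ∈ Icc (0 : ℝ) 1) :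
    0 ≤ slopeKernel ν z r := by
  have h1 := two_sub_pos hz
  have h2 := two_sub_pos (mul_mem_base hz hr)
  have := hr.1
  unfold slopeKernel
  positivity

theorem slopeKernel_le {ν z r : ℝ} (hν : 1 ≤ ν) (hz : z ∈ Icc (0 : ℝ) 1)
    (hr : r ∈ Icc (0 : ℝ) 1) : slopeKernel ν z r ≤ 2 ^ (ν - 1) := by
  have h0 : 0 ≤ ν - 1 := by linarith
  have hz' : z ∈ Icc (-1 : ℝ) (3 / 2) := ⟨by linarith [hz.1], by linarith [hz.2]⟩
  have h1 := two_sub_pos hz'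
  have h2 := two_sub_pos (mul_mem_base hz' hr)
  have h3 : r ^ (ν - 1) ≤ 1 := Real.rpow_le_one hr.1 hr.2 h0
  have h4 : (2 - z * r) ^ (ν - 1) ≤ 2 ^ (ν - 1) :=
    Real.rpow_le_rpow h2.le (by nlinarith [hz.1, hr.1, mul_nonneg hz.1 hr.1]) h0
  have h5 : (2 - z) ^ (-ν) ≤ 1 :=
    Real.rpow_le_one_of_one_le_of_nonpos (by linarith [hz.2]) (by linarith)
  have h6 : 0 ≤ (2 - z) ^ (-ν) := Real.rpow_nonneg h1.le _
  have h7 : (0 : ℝ) ≤ 2 ^ (ν - 1) := by positivity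
  unfold slopeKernel
  calc r ^ (ν - 1) * (2 - z * r) ^ (ν - 1) * (2 - z) ^ (-ν)
      ≤ 1 * 2 ^ (ν - 1) * 1 := by gcongr
    _ = _ := by ring

theorem abs_regularSlope_le {ν b z : ℝ} (hν : 1 ≤ ν) {F g : ℝ → ℝ} (hz : z ∈ Icc (0 : ℝ) 1)
    (h : ∀ x ∈ Icc (0 : ℝ) z, |F (g x)| ≤ b) : |regularSlope ν F g z| ≤ 2 ^ (ν - 1) * b := by
  have hz' : z ∈ Icc (-1 : ℝ) (3 / 2) := ⟨by linarith [hz.1], by linarith [hz.2]⟩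
  have hb : ∀ r ∈ uIoc (0 : ℝ) 1, ‖slopeKernel ν (clampBase z) r * F (g (clampBase z * r))‖ ≤
      2 ^ (ν - 1) * b := by
    intro r hr
    rw [uIoc_of_le zero_le_one] at hr
    have hr' : r ∈ Icc (0 : ℝ) 1 := ⟨hr.1.le, hr.2⟩
    rw [clampBase_of_mem hz', norm_mul, Real.norm_eq_abs, Real.norm_eq_abs,
      abs_of_nonneg (slopeKernel_nonneg hz' hr')]
    exact mul_le_mul (slopeKernel_le hν hz hr') (h _ ⟨mul_nonneg hz.1 hr'.1,
      mul_le_of_le_one_right hz.1 hr'.2⟩) (abs_nonneg _) (by positivity)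
  have := intervalIntegral.norm_integral_le_of_norm_le_const hb
  simpa [regularSlope] using this

theorem regularSlope_nonpos {ν z : ℝ} {F g : ℝ → ℝ} (hz : z ∈ Icc (0 : ℝ) 1)
    (h : ∀ x ∈ Icc (0 : ℝ) z, F (g x) ≤ 0) : regularSlope ν F g z ≤ 0 := by
  have hz' : z ∈ Icc (-1 : ℝ) (3 / 2) := ⟨by linarith [hz.1], by linarith [hz.2]⟩
  have : 0 ≤ ∫ r in (0 : ℝ)..1, -(slopeKernel ν (clampBase z) r * F (g (clampBase z * r))) := by
    refine intervalIntegral.integral_nonneg zero_le_one fun r hr => ?_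
    rw [clampBase_of_mem hz', ← mul_neg]
    exact mul_nonneg (slopeKernel_nonneg hz' hr) (neg_nonneg.mpr (h _ ⟨mul_nonneg hz.1 hr.1,
      mul_le_of_le_one_right hz.1 hr.2⟩))
  rw [intervalIntegral.integral_neg] at this
  simpa [regularSlope] using this

/-! ### Truncation and a priori bounds -/

/-- A continuous function that is positive at the left endpoint and cannot vanish at the end of an
interval of positivity is positive throughout. -/
theorem pos_of_forall_prefix {f : ℝ → ℝ} {a b : ℝ} (hf : ContinuousOn f (Icc a b)) (ha : 0 < f a)
    (h : ∀ c ∈ Ioc a b, (∀ x ∈ Ico a c, 0 < f x) → f c ≠ 0) : ∀ x ∈ Icc a b, 0 < f x := by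
  by_contra! hcon
  obtain ⟨x, hx, hfx⟩ := hcon
  have hS : IsCompact (Icc a b ∩ f ⁻¹' Iic 0) :=
    isCompact_Icc.of_isClosed_subset (hf.preimage_isClosed_of_isClosed isClosed_Icc isClosed_Iic)
      inter_subset_left
  obtain ⟨c, ⟨hc, hfc⟩, hmin⟩ := hS.exists_isLeast ⟨x, hx, hfx⟩
  have hac : a < c := lt_of_le_of_ne hc.1 (fun h => by
    subst h
    exact absurd hfc (not_le.mpr ha))
  have hpre : ∀ y ∈ Ico a c, 0 < f y := fun y hy => by
    by_contra hy'
    exact absurd (hmin ⟨⟨hy.1, hy.2.le.trans hc.2⟩, not_lt.mp hy'⟩) (not_le.mpr hy.2)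
  have hge : 0 ≤ f c := by
    have h1 : ContinuousWithinAt f (Ico a c) c :=
      (hf c hc).mono fun y hy => ⟨hy.1, hy.2.le.trans hc.2⟩
    have : (𝓝[Ico a c] c).NeBot := by
      rw [nhdsWithin_Ico_eq_nhdsLT hac]
      infer_instance
    exact ge_of_tendsto h1 (eventually_of_mem self_mem_nhdsWithin fun y hy => (hpre y hy).le)
  exact h c ⟨hac, hc.2⟩ hpre (le_antisymm hfc hge)

/-- The right-hand side `μ x - x ^ p`, modified outside `[0, M]` to a continuously differentiable
and globally Lipschitz function. -/
noncomputable def truncatedRHS (μ p M x : ℝ) : ℝ :=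
  ∫ ξ in (0 : ℝ)..x, (μ - p * max 0 (min ξ M) ^ (p - 1))

section Truncation

variable {μ p M : ℝ}

theorem hasDerivAt_truncatedRHS (hp : 1 < p) (x : ℝ) :
    HasDerivAt (truncatedRHS μ p M) (μ - p * max 0 (min x M) ^ (p - 1)) x := by
  have hc : Continuous fun ξ : ℝ => μ - p * max 0 (min ξ M) ^ (p - 1) := by
    have : Continuous fun ξ : ℝ => max 0 (min ξ M) ^ (p - 1) :=
      Continuous.rpow_const (by fun_prop) fun _ => Or.inr (by linarith)
    fun_prop
  exact intervalIntegral.integral_hasDerivAt_right (hc.intervalIntegrable _ _)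
    (hc.stronglyMeasurableAtFilter _ _) hc.continuousAt

theorem contDiff_truncatedRHS (hp : 1 < p) : ContDiff ℝ 1 (truncatedRHS μ p M) := by
  rw [contDiff_one_iff_deriv]
  refine ⟨fun x => (hasDerivAt_truncatedRHS hp x).differentiableAt, ?_⟩
  rw [show deriv (truncatedRHS μ p M) = fun x => μ - p * max 0 (min x M) ^ (p - 1) from
    funext fun x => (hasDerivAt_truncatedRHS hp x).deriv]
  have : Continuous fun ξ : ℝ => max 0 (min ξ M) ^ (p - 1) :=
    Continuous.rpow_const (by fun_prop) fun _ => Or.inr (by linarith)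
  fun_prop

theorem exists_lipschitzWith_truncatedRHS (hp : 1 < p) (hM : 0 ≤ M) :
    ∃ L, LipschitzWith L (truncatedRHS μ p M) := by
  refine ⟨(|μ| + p * M ^ (p - 1)).toNNReal, lipschitzWith_of_nnnorm_deriv_le
    (fun x => (hasDerivAt_truncatedRHS hp x).differentiableAt) fun x => ?_⟩
  rw [(hasDerivAt_truncatedRHS hp x).deriv, ← NNReal.coe_le_coe, coe_nnnorm,
    Real.coe_toNNReal _ (by positivity), Real.norm_eq_abs]
  have h1 : max 0 (min x M) ^ (p - 1) ≤ M ^ (p - 1) :=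
    Real.rpow_le_rpow (le_max_left _ _) (max_le hM (min_le_right _ _)) (by linarith)
  have h2 : 0 ≤ max 0 (min x M) ^ (p - 1) := Real.rpow_nonneg (le_max_left _ _) _
  calc |μ - p * max 0 (min x M) ^ (p - 1)| ≤ |μ| + |p * max 0 (min x M) ^ (p - 1)| := abs_sub _ _
    _ ≤ _ := by
      rw [abs_of_nonneg (mul_nonneg (by linarith) h2)]
      gcongr

theorem truncatedRHS_of_mem (hp : 1 < p) {x : ℝ} (hx : x ∈ Icc 0 M) :
    truncatedRHS μ p M x = μ * x - x ^ p := by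
  have h : ∀ ξ ∈ uIcc 0 x, HasDerivAt (fun ξ : ℝ => μ * ξ - ξ ^ p)
      (μ - p * max 0 (min ξ M) ^ (p - 1)) ξ := by
    intro ξ hξ
    rw [uIcc_of_le hx.1] at hξ
    rw [min_eq_left (hξ.2.trans hx.2), max_eq_right hξ.1]
    exact (((hasDerivAt_id ξ).const_mul μ).sub
      (Real.hasDerivAt_rpow_const (x := ξ) (p := p) (Or.inr hp.le))).congr_deriv (by simp)
  have hc : Continuous fun ξ : ℝ => μ - p * max 0 (min ξ M) ^ (p - 1) := by
    have : Continuous fun ξ : ℝ => max 0 (min ξ M) ^ (p - 1) :=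
      Continuous.rpow_const (by fun_prop) fun _ => Or.inr (by linarith)
    fun_prop
  rw [truncatedRHS, intervalIntegral.integral_eq_sub_of_hasDerivAt h (hc.intervalIntegrable _ _)]
  simp [Real.zero_rpow (by linarith : p ≠ 0)]

theorem truncatedRHS_neg (hp : 1 < p) {α x : ℝ} (hα : 0 < α) (hαM : α ≤ M)
    (hμ : μ < α ^ (p - 1)) (hx : α ≤ x) : truncatedRHS μ p M x < 0 := by
  have h1 : AntitoneOn (truncatedRHS μ p M) (Ici α) := by
    refine antitoneOn_of_deriv_nonpos (convex_Ici α)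
      (contDiff_truncatedRHS hp).continuous.continuousOn
      (fun x _ => (hasDerivAt_truncatedRHS hp x).differentiableAt.differentiableWithinAt)
      fun y hy => ?_
    rw [interior_Ici] at hy
    rw [(hasDerivAt_truncatedRHS hp y).deriv]
    have h2 : α ^ (p - 1) ≤ max 0 (min y M) ^ (p - 1) :=
      Real.rpow_le_rpow hα.le (le_max_of_le_right (le_min (le_of_lt hy) hαM)) (by linarith)
    have h3 : 0 < α ^ (p - 1) := Real.rpow_pos_of_pos hα _
    nlinarith
  have h2 := h1 (mem_Ici.mpr le_rfl) (mem_Ici.mpr hx) hx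
  rw [truncatedRHS_of_mem hp ⟨hα.le, hαM⟩] at h2
  have h3 : α ^ p = α ^ (p - 1) * α := by
    rw [Real.rpow_sub_one hα.ne']
    field_simp
  nlinarith

end Truncation

/-- The energy `z (2 - z) h² / 2 - ∫ F` is nonincreasing along a regular solution, so a solution
starting at `α` stays below `α` if `F < 0` above `α`. -/
theorem le_initial_of_regular_solution {ν α : ℝ} (hν : 1 ≤ ν) {F g : ℝ → ℝ}
    (hF : ContDiff ℝ 1 F) (hg : ∀ z, HasDerivAt g (regularSlope ν F g z) z) (hg0 : g 0 = α)
    (hneg : ∀ x, α ≤ x → F x < 0) {z : ℝ} (hz : z ∈ Icc (0 : ℝ) 1) : g z ≤ α := by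
  set h := regularSlope ν F g with hh
  set P : ℝ → ℝ := fun x => ∫ ξ in α..x, F ξ with hP
  have hFc := hF.continuous
  have hgc : Continuous g := continuous_iff_continuousAt.mpr fun z => (hg z).continuousAt
  have hhc : Continuous h := continuous_regularSlope hν hFc hgc
  have hPd : ∀ x, HasDerivAt P (F x) x := fun x =>
    intervalIntegral.integral_hasDerivAt_right (hFc.intervalIntegrable _ _)
      (hFc.stronglyMeasurableAtFilter _ _) hFc.continuousAt
  have hPc : Continuous P := continuous_iff_continuousAt.mpr fun z => (hPd z).continuousAt
  have hanti : AntitoneOn (fun z => z * (2 - z) * h z ^ 2 / 2 - P (g z)) (Icc 0 1) := by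
    have hd : ∀ z ∈ Ioo (0 : ℝ) 1, HasDerivAt (fun z => z * (2 - z) * h z ^ 2 / 2 - P (g z))
        (-(2 * ν - 1) * (1 - z) * h z ^ 2) z := by
      intro z hz
      have h1 := hasDerivAt_regularSlope hν hF hg (z := z)
        ⟨by linarith [hz.1], by linarith [hz.2]⟩
      have h2 := regularSlope_ode hν hF hg (z := z) ⟨hz.1.le, by linarith [hz.2]⟩
      rw [← hh] at h1 h2
      have h3 := (((hasDerivAt_id z).mul ((hasDerivAt_id z).const_sub 2)).mul
        (h1.pow 2)).div_const 2
      have h4 := (hPd (g z)).comp z (hg z)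
      refine (h3.sub h4).congr_deriv ?_
      simp only [id, Pi.mul_apply, Pi.pow_apply]
      norm_num
      linear_combination (h z) * h2
    refine antitoneOn_of_deriv_nonpos (convex_Icc _ _) (by fun_prop) ?_ ?_
    · rw [interior_Icc]
      exact fun z hz => (hd z hz).differentiableAt.differentiableWithinAt
    · rw [interior_Icc]
      intro z hz
      rw [(hd z hz).deriv]
      have : 0 ≤ (2 * ν - 1) * (1 - z) * h z ^ 2 :=
        mul_nonneg (mul_nonneg (by linarith) (by linarith [hz.2])) (sq_nonneg _)
      linarith
  have h1 := hanti (left_mem_Icc.mpr zero_le_one) hz hz.1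
  simp only [hg0] at h1
  have h2 : P α = 0 := by simp [hP]
  have h3 : 0 ≤ z * (2 - z) * h z ^ 2 / 2 := by
    have : 0 ≤ 2 - z := by linarith [hz.2]
    have := hz.1
    positivity
  by_contra! hlt
  have h4 : P (g z) < 0 := by
    have := intervalIntegral.intervalIntegral_pos_of_pos_on
      (f := fun x => -F x) (hFc.neg.intervalIntegrable _ _)
      (fun x hx => neg_pos.mpr (hneg x hx.1.le)) hlt
    rw [intervalIntegral.integral_neg] at this
    simp only [hP]
    linarith
  simp at h1
  linarith

/-- As long as `z` is small compared with `α ^ (1 - p)`, the solution starting at a large `α`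
stays above `α / 2` and its slope is negative and at most of the order of `α ^ p`. -/
theorem regular_solution_near_pole {ν μ p α z₁ : ℝ} (hν : 1 ≤ ν) (hμ0 : 0 ≤ μ) (hp : 1 < p)
    (hα : 0 < α) {F g : ℝ → ℝ} (hF : ∀ x ∈ Icc 0 α, F x = μ * x - x ^ p)
    (hg : ∀ z, HasDerivAt g (regularSlope ν F g z) z) (hg0 : g 0 = α)
    (hle : ∀ z ∈ Icc (0 : ℝ) 1, g z ≤ α) (hμ : μ ≤ (α / 2) ^ (p - 1)) (hz₁ : z₁ ∈ Icc (0 : ℝ) 1)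
    (hsmall : 2 ^ (ν - 1) * α ^ p * z₁ ≤ α / 4) {z : ℝ} (hz : z ∈ Icc 0 z₁) :
    α / 2 < g z ∧ regularSlope ν F g z ≤ 0 ∧ -(2 ^ (ν - 1) * α ^ p) ≤ regularSlope ν F g z := by
  have hgc : Continuous g := continuous_iff_continuousAt.mpr fun z => (hg z).continuousAt
  have hFb : ∀ x ∈ Icc (α / 2) α, F x ≤ 0 ∧ -(α ^ p) ≤ F x := by
    intro x hx
    have hx0 : 0 < x := by linarith [hx.1]
    rw [hF x ⟨hx0.le, hx.2⟩]
    have h1 : x ^ p = x ^ (p - 1) * x := by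
      rw [Real.rpow_sub_one hx0.ne']
      field_simp
    have h2 : (α / 2) ^ (p - 1) ≤ x ^ (p - 1) :=
      Real.rpow_le_rpow (by positivity) hx.1 (by linarith)
    have h3 : x ^ p ≤ α ^ p := Real.rpow_le_rpow hx0.le hx.2 (by linarith)
    constructor
    · nlinarith
    · nlinarith
  have hslope : ∀ c ∈ Icc (0 : ℝ) 1, (∀ x ∈ Icc 0 c, α / 2 ≤ g x) →
      regularSlope ν F g c ≤ 0 ∧ |regularSlope ν F g c| ≤ 2 ^ (ν - 1) * α ^ p := by
    intro c hc hx
    have hx' : ∀ x ∈ Icc 0 c, g x ∈ Icc (α / 2) α := fun x h =>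
      ⟨hx x h, hle x ⟨h.1, h.2.trans hc.2⟩⟩
    refine ⟨regularSlope_nonpos hc fun x h => (hFb _ (hx' x h)).1,
      abs_regularSlope_le hν hc fun x h => abs_le.mpr ⟨(hFb _ (hx' x h)).2, ?_⟩⟩
    exact (hFb _ (hx' x h)).1.trans (by positivity)
  have hpos : ∀ x ∈ Icc 0 z₁, 0 < g x - α / 2 := by
    refine pos_of_forall_prefix (by fun_prop) (by rw [hg0]; linarith) fun c hc hpre => ?_
    have hge : ∀ x ∈ Icc 0 c, α / 2 ≤ g x := by
      have : IsClosed {x | α / 2 ≤ g x} := isClosed_le continuous_const hgc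
      have h2 := this.closure_subset_iff.mpr
        (fun x hx => (by linarith [hpre x hx] : α / 2 ≤ g x) : Ico 0 c ⊆ {x | α / 2 ≤ g x})
      rwa [closure_Ico hc.1.ne] at h2
    have h1 := (convex_Icc 0 c).norm_image_sub_le_of_norm_hasDerivWithin_le
      (f := g) (f' := regularSlope ν F g) (C := 2 ^ (ν - 1) * α ^ p)
      (fun x _ => (hg x).hasDerivWithinAt)
      (fun x hx => (hslope x ⟨hx.1, hx.2.trans (hc.2.trans hz₁.2)⟩ fun y hy =>
        hge y ⟨hy.1, hy.2.trans hx.2⟩).2)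
      (left_mem_Icc.mpr hc.1.le) (right_mem_Icc.mpr hc.1.le)
    rw [hg0, Real.norm_eq_abs, Real.norm_eq_abs, sub_zero, abs_of_pos hc.1] at h1
    have h2 : 2 ^ (ν - 1) * α ^ p * c ≤ 2 ^ (ν - 1) * α ^ p * z₁ :=
      mul_le_mul_of_nonneg_left hc.2 (by positivity)
    have h3 := (abs_le.mp h1).1
    have : 0 < g c - α / 2 := by linarith
    exact this.ne'
  have h := hslope z ⟨hz.1, hz.2.trans hz₁.2⟩ fun x hx => by
    linarith [hpos x ⟨hx.1, hx.2.trans hz.2⟩]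
  exact ⟨by linarith [hpos z hz], h.1, (abs_le.mp h.2).1⟩

/-! ### Phase of a damped oscillator -/

/-- A solution of the damped equation `w'' = -a c(t) w' - q(t)` on `[t₁, 0]`, with velocity `v`;
the forcing `q` will be a nonlinear restoring force evaluated along the solution. -/
structure DampedOrbit (a t₁ : ℝ) (c q w v : ℝ → ℝ) : Prop where
  neg : t₁ < 0
  cont_c : Continuous c
  cont_q : Continuous q
  deriv_w : ∀ t ∈ Icc t₁ 0, HasDerivAt w (v t) t
  deriv_v : ∀ t ∈ Icc t₁ 0, HasDerivAt v (-(a * c t * v t) - q t) t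
  c_nonneg : ∀ t ∈ Icc t₁ 0, 0 ≤ c t
  c_le_one : ∀ t ∈ Icc t₁ 0, c t ≤ 1
  start_neg : w t₁ < 0

/-- The angular velocity at which `(-w, v)` turns around the origin. -/
noncomputable def angularSpeed (a : ℝ) (c q w v : ℝ → ℝ) (t : ℝ) : ℝ :=
  (v t ^ 2 + a * c t * w t * v t + w t * q t) / (w t ^ 2 + v t ^ 2)

/-- The polar angle of `(-w, v)`, normalised to lie in `(-π / 2, π / 2)` at time `t₁`. -/
noncomputable def phase (a t₁ : ℝ) (c q w v : ℝ → ℝ) (t : ℝ) : ℝ :=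
  Real.arctan (v t₁ / -w t₁) + ∫ s in t₁..t, angularSpeed a c q w v s

namespace DampedOrbit

variable {a t₁ K : ℝ} {c q w v : ℝ → ℝ}

theorem continuousOn_w (h : DampedOrbit a t₁ c q w v) : ContinuousOn w (Icc t₁ 0) :=
  fun t ht => (h.deriv_w t ht).continuousAt.continuousWithinAt

theorem continuousOn_v (h : DampedOrbit a t₁ c q w v) : ContinuousOn v (Icc t₁ 0) :=
  fun t ht => (h.deriv_v t ht).continuousAt.continuousWithinAt

/-- The orbit cannot reach the equilibrium in finite time. -/
theorem radius_pos (h : DampedOrbit a t₁ c q w v) (ha : 0 ≤ a)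
    (hq : ∀ t ∈ Icc t₁ 0, |q t| ≤ K * |w t|) {t : ℝ} (ht : t ∈ Icc t₁ 0) :
    0 < w t ^ 2 + v t ^ 2 := by
  -- the logarithmic derivative of `w² + v²` is at least `-K'`
  set K' := 2 + 2 * a + K ^ 2 with hK'
  have hmono : MonotoneOn (fun t => (w t ^ 2 + v t ^ 2) * Real.exp (K' * t)) (Icc t₁ 0) := by
    have hd : ∀ t ∈ Icc t₁ 0, HasDerivAt (fun t => (w t ^ 2 + v t ^ 2) * Real.exp (K' * t))
        ((2 * w t * v t + 2 * v t * (-(a * c t * v t) - q t) + K' * (w t ^ 2 + v t ^ 2)) *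
          Real.exp (K' * t)) t := by
      intro t ht
      have h1 := ((((h.deriv_w t ht).pow 2).add ((h.deriv_v t ht).pow 2)).mul
        ((hasDerivAt_id t).const_mul K').exp)
      refine h1.congr_deriv ?_
      simp only [id, Pi.add_apply, Pi.pow_apply]
      norm_num
      ring
    refine monotoneOn_of_deriv_nonneg (convex_Icc _ _)
      (fun t ht => (hd t ht).continuousAt.continuousWithinAt)
      (fun t ht => (hd t (interior_subset ht)).differentiableAt.differentiableWithinAt)
      fun t ht => ?_
    have ht' := interior_subset ht
    rw [(hd t ht').deriv]
    refine mul_nonneg ?_ (Real.exp_pos _).le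
    have h2 : q t ^ 2 ≤ K ^ 2 * w t ^ 2 := by
      have := pow_le_pow_left₀ (abs_nonneg _) (hq t ht') 2
      rwa [mul_pow, sq_abs, sq_abs] at this
    have h3 : a * c t * v t ^ 2 ≤ a * v t ^ 2 := by
      have := mul_le_mul_of_nonneg_left (h.c_le_one t ht') (mul_nonneg ha (sq_nonneg (v t)))
      linarith
    nlinarith [sq_nonneg (w t + v t), sq_nonneg (v t - q t), mul_nonneg ha (sq_nonneg (w t)),
      mul_nonneg (sq_nonneg K) (sq_nonneg (v t))]
  have h1 := hmono (left_mem_Icc.mpr h.neg.le) ht ht.1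
  have h2 : 0 < (w t₁ ^ 2 + v t₁ ^ 2) * Real.exp (K' * t₁) := by
    have := h.start_neg
    have : 0 < w t₁ ^ 2 := by nlinarith
    exact mul_pos (by positivity) (Real.exp_pos _)
  exact pos_of_mul_pos_left (h2.trans_le h1) (Real.exp_pos _).le

theorem continuousOn_angularSpeed (h : DampedOrbit a t₁ c q w v)
    (hr : ∀ t ∈ Icc t₁ 0, 0 < w t ^ 2 + v t ^ 2) :
    ContinuousOn (angularSpeed a c q w v) (Icc t₁ 0) := by
  have h1 := h.continuousOn_w
  have h2 := h.continuousOn_v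
  have h3 := h.cont_c.continuousOn (s := Icc t₁ 0)
  have h4 := h.cont_q.continuousOn (s := Icc t₁ 0)
  exact ContinuousOn.div (by fun_prop) (by fun_prop) fun t ht => (hr t ht).ne'

theorem continuousOn_phase (h : DampedOrbit a t₁ c q w v)
    (hr : ∀ t ∈ Icc t₁ 0, 0 < w t ^ 2 + v t ^ 2) :
    ContinuousOn (phase a t₁ c q w v) (Icc t₁ 0) := by
  have h1 := intervalIntegral.continuousOn_primitive_interval (a := t₁) (b := 0)
    (f := angularSpeed a c q w v) (μ := MeasureTheory.volume)
    (by
      rw [uIcc_of_le h.neg.le]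
      exact (h.continuousOn_angularSpeed hr).integrableOn_Icc)
  rw [uIcc_of_le h.neg.le] at h1
  exact continuousOn_const.add h1

theorem hasDerivAt_phase (h : DampedOrbit a t₁ c q w v)
    (hr : ∀ t ∈ Icc t₁ 0, 0 < w t ^ 2 + v t ^ 2) {t : ℝ} (ht : t ∈ Ioo t₁ 0) :
    HasDerivAt (phase a t₁ c q w v) (angularSpeed a c q w v t) t := by
  have h1 := h.continuousOn_angularSpeed hr
  have h2 := h1.mono Ioo_subset_Icc_self
  refine (intervalIntegral.integral_hasDerivAt_right ?_
    (h2.stronglyMeasurableAtFilter isOpen_Ioo t ht)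
    (h2.continuousAt (isOpen_Ioo.mem_nhds ht))).const_add _
  refine ContinuousOn.intervalIntegrable (h1.mono ?_)
  rw [uIcc_of_le ht.1.le]
  exact Icc_subset_Icc_right ht.2.le

/-- The vector `(w, v)` points in the direction `(-cos φ, sin φ)`: the quantity
`(w sin φ + v cos φ)² / (w² + v²)` is constant and vanishes at the start. -/
theorem phase_spec (h : DampedOrbit a t₁ c q w v)
    (hr : ∀ t ∈ Icc t₁ 0, 0 < w t ^ 2 + v t ^ 2) {t : ℝ} (ht : t ∈ Icc t₁ 0) :
    w t * Real.sin (phase a t₁ c q w v t) + v t * Real.cos (phase a t₁ c q w v t) = 0 := by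
  set φ := phase a t₁ c q w v with hφ
  set D : ℝ → ℝ := fun t => w t * Real.sin (φ t) + v t * Real.cos (φ t) with hD
  have hw := h.continuousOn_w
  have hv := h.continuousOn_v
  have hφc : ContinuousOn φ (Icc t₁ 0) := h.continuousOn_phase hr
  have hconst : ∀ t ∈ Icc t₁ 0, D t ^ 2 / (w t ^ 2 + v t ^ 2) =
      D t₁ ^ 2 / (w t₁ ^ 2 + v t₁ ^ 2) := by
    set R : ℝ → ℝ := fun t => D t ^ 2 / (w t ^ 2 + v t ^ 2) with hR
    have hRc : ContinuousOn R (Icc t₁ 0) :=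
      ContinuousOn.div (by fun_prop) (by fun_prop) fun t ht => (hr t ht).ne'
    have hRd : ∀ t ∈ interior (Icc t₁ 0), HasDerivAt R 0 t := by
      intro t ht
      have ht' := interior_subset ht
      rw [interior_Icc] at ht
      have hr0 := (hr t ht').ne'
      have h1 := h.deriv_w t ht'
      have h2 := h.deriv_v t ht'
      have h3 : HasDerivAt φ (angularSpeed a c q w v t) t := h.hasDerivAt_phase hr ht
      have h4 := (((h1.mul h3.sin).add (h2.mul h3.cos)).pow 2).div ((h1.pow 2).add (h2.pow 2)) hr0
      refine h4.congr_deriv ?_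
      simp only [Pi.add_apply, Pi.mul_apply, Pi.pow_apply]
      have h5 : angularSpeed a c q w v t * (w t ^ 2 + v t ^ 2) =
          v t ^ 2 + a * c t * w t * v t + w t * q t := div_mul_cancel₀ _ hr0
      rw [div_eq_zero_iff]
      left
      norm_num
      generalize angularSpeed a c q w v t = Ω at h5 ⊢
      linear_combination (2 * (w t * Real.sin (φ t) + v t * Real.cos (φ t)) *
        (w t * Real.cos (φ t) - v t * Real.sin (φ t))) * h5
    have hdiff : DifferentiableOn ℝ R (interior (Icc t₁ 0)) := fun t ht =>
      (hRd t ht).differentiableAt.differentiableWithinAt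
    have hup := monotoneOn_of_deriv_nonneg (convex_Icc t₁ 0) hRc hdiff
      fun t ht => (hRd t ht).deriv.ge
    have hdown := antitoneOn_of_deriv_nonpos (convex_Icc t₁ 0) hRc hdiff
      fun t ht => (hRd t ht).deriv.le
    have hl := left_mem_Icc.mpr h.neg.le
    exact fun t ht => le_antisymm (hdown hl ht ht.1) (hup hl ht ht.1)
  have h0 : D t₁ = 0 := by
    have hw1 := h.start_neg
    have h1 : φ t₁ = Real.arctan (v t₁ / -w t₁) := by simp [hφ, phase]
    have h2 := (Real.cos_arctan_pos (v t₁ / -w t₁)).ne'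
    have h3 := Real.tan_arctan (v t₁ / -w t₁)
    rw [Real.tan_eq_sin_div_cos, div_eq_iff h2] at h3
    simp only [hD, h1, h3]
    field_simp [hw1.ne]
    ring
  have h1 := hconst t ht
  rw [h0, zero_pow two_ne_zero, zero_div, div_eq_zero_iff] at h1
  rcases h1 with h1 | h1
  · exact pow_eq_zero_iff two_ne_zero |>.mp h1
  · exact absurd h1 (hr t ht).ne'

/-- When the phase at the final time is a multiple of `π`, the final velocity vanishes. -/
theorem velocity_eq_zero (h : DampedOrbit a t₁ c q w v)
    (hr : ∀ t ∈ Icc t₁ 0, 0 < w t ^ 2 + v t ^ 2) {k : ℤ}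
    (hk : phase a t₁ c q w v 0 = k * Real.pi) : v 0 = 0 := by
  have h1 := h.phase_spec hr (right_mem_Icc.mpr h.neg.le)
  rw [hk, Real.sin_int_mul_pi, mul_zero, zero_add] at h1
  refine (mul_eq_zero.mp h1).resolve_right fun h2 => ?_
  have h3 := Real.sin_sq_add_cos_sq (k * Real.pi)
  rw [Real.sin_int_mul_pi, h2] at h3
  norm_num at h3

theorem phase_sub_mono (h : DampedOrbit a t₁ c q w v)
    (hr : ∀ t ∈ Icc t₁ 0, 0 < w t ^ 2 + v t ^ 2) {S S' : ℝ → ℝ} {s₁ s₂ : ℝ} (h₁ : t₁ ≤ s₁)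
    (h₁₂ : s₁ ≤ s₂) (h₂ : s₂ ≤ 0) (hS : ∀ t ∈ Icc s₁ s₂, HasDerivAt S (S' t) t)
    (hle : ∀ t ∈ Icc s₁ s₂, S' t ≤ angularSpeed a c q w v t) :
    S s₂ - S s₁ ≤ phase a t₁ c q w v s₂ - phase a t₁ c q w v s₁ := by
  have hsub : Icc s₁ s₂ ⊆ Icc t₁ 0 := Icc_subset_Icc h₁ h₂
  have hmono : MonotoneOn (fun t => phase a t₁ c q w v t - S t) (Icc s₁ s₂) := by
    have hd : ∀ t ∈ interior (Icc s₁ s₂), HasDerivAt (fun t => phase a t₁ c q w v t - S t)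
        (angularSpeed a c q w v t - S' t) t := by
      intro t ht
      have h5 := interior_subset ht
      rw [interior_Icc] at ht
      exact (h.hasDerivAt_phase hr ⟨h₁.trans_lt ht.1, ht.2.trans_le h₂⟩).sub (hS t h5)
    refine monotoneOn_of_deriv_nonneg (convex_Icc _ _)
      (((h.continuousOn_phase hr).mono hsub).sub fun t ht =>
        (hS t ht).continuousAt.continuousWithinAt)
      (fun t ht => (hd t ht).differentiableAt.differentiableWithinAt) fun t ht => ?_
    rw [(hd t ht).deriv]
    linarith [hle t (interior_subset ht)]
  have := hmono (left_mem_Icc.mpr h₁₂) (right_mem_Icc.mpr h₁₂) h₁₂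
  simp only at this
  linarith

theorem neg_le_angularSpeed (h : DampedOrbit a t₁ c q w v) (ha : 0 ≤ a)
    (hr : ∀ t ∈ Icc t₁ 0, 0 < w t ^ 2 + v t ^ 2) {t : ℝ} (ht : t ∈ Icc t₁ 0)
    (hq : 0 ≤ w t * q t) : -(a / 2) ≤ angularSpeed a c q w v t := by
  rw [angularSpeed, le_div_iff₀ (hr t ht)]
  have h1 := h.c_nonneg t ht
  have h2 := h.c_le_one t ht
  have h3 : |w t * v t| ≤ (w t ^ 2 + v t ^ 2) / 2 := by
    rw [abs_le]
    constructor <;> nlinarith [sq_nonneg (w t + v t), sq_nonneg (w t - v t)]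
  have h4 : -(a * |w t * v t|) ≤ a * c t * w t * v t := by
    have h5 : |a * c t * (w t * v t)| ≤ a * |w t * v t| := by
      rw [abs_mul, abs_of_nonneg (mul_nonneg ha h1)]
      have := mul_le_mul_of_nonneg_left h2 (mul_nonneg ha (abs_nonneg (w t * v t)))
      linarith
    have := (abs_le.mp h5).1
    linarith
  nlinarith [sq_nonneg (v t), mul_le_mul_of_nonneg_left h3 ha]

theorem angularSpeed_le (h : DampedOrbit a t₁ c q w v) (ha : 0 ≤ a) (hK : 0 ≤ K)
    (hr : ∀ t ∈ Icc t₁ 0, 0 < w t ^ 2 + v t ^ 2) {t : ℝ} (ht : t ∈ Icc t₁ 0)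
    (hq : w t * q t ≤ K * w t ^ 2) : angularSpeed a c q w v t ≤ 1 + a + K := by
  rw [angularSpeed, div_le_iff₀ (hr t ht)]
  have h1 := h.c_nonneg t ht
  have h2 := h.c_le_one t ht
  have h3 : |w t * v t| ≤ w t ^ 2 + v t ^ 2 := by
    rw [abs_le]
    constructor <;> nlinarith [sq_nonneg (w t + v t), sq_nonneg (w t - v t)]
  have h5 : |a * c t * (w t * v t)| ≤ a * |w t * v t| := by
    rw [abs_mul, abs_of_nonneg (mul_nonneg ha h1)]
    have := mul_le_mul_of_nonneg_left h2 (mul_nonneg ha (abs_nonneg (w t * v t)))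
    linarith
  have := (abs_le.mp h5).2
  nlinarith [sq_nonneg (v t), sq_nonneg (w t), mul_le_mul_of_nonneg_left h3 ha,
    mul_nonneg hK (sq_nonneg (v t))]

/-- If the restoring force beats the damping, `k₀ > a² / 4`, the orbit turns at a definite rate. -/
theorem le_angularSpeed (h : DampedOrbit a t₁ c q w v) {k₀ σ : ℝ}
    (hσ : a ^ 2 ≤ 4 * ((1 - σ) * (k₀ - σ))) (hσ1 : σ < 1)
    (hr : ∀ t ∈ Icc t₁ 0, 0 < w t ^ 2 + v t ^ 2) {t : ℝ} (ht : t ∈ Icc t₁ 0)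
    (hq : k₀ * w t ^ 2 ≤ w t * q t) : σ ≤ angularSpeed a c q w v t := by
  rw [angularSpeed, le_div_iff₀ (hr t ht)]
  have h1 := h.c_nonneg t ht
  have h2 := h.c_le_one t ht
  have hc : c t ^ 2 ≤ 1 := by nlinarith
  have h3 : (a * c t) ^ 2 ≤ 4 * ((1 - σ) * (k₀ - σ)) := by
    refine le_trans ?_ hσ
    rw [mul_pow]
    nlinarith [sq_nonneg a]
  have h4 : 0 ≤ (1 - σ) * v t ^ 2 + a * c t * w t * v t + (k₀ - σ) * w t ^ 2 := by
    have h5 : 0 ≤ 4 * (1 - σ) *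
        ((1 - σ) * v t ^ 2 + a * c t * w t * v t + (k₀ - σ) * w t ^ 2) := by
      nlinarith [sq_nonneg (2 * (1 - σ) * v t + a * c t * w t),
        mul_le_mul_of_nonneg_right h3 (sq_nonneg (w t))]
    exact nonneg_of_mul_nonneg_right h5 (by linarith)
  nlinarith

/-- A lower bound for the total rotation. The Lyapunov function `E + κ v w` decreases at least
like `w²` as long as the damping is effective (`t ≤ -1`), so the orbit spends only a bounded time
away from the equilibrium, and near the equilibrium it turns at speed at least `σ`. -/
theorem phase_lower_bound (h : DampedOrbit a t₁ c q w v) (ha : 0 < a) {k₀ k₁ σ ρ b κ : ℝ}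
    (hσ0 : 0 < σ) (hσ : a ^ 2 ≤ 4 * ((1 - σ) * (k₀ - σ))) (hσ1 : σ < 1)
    (hr : ∀ t ∈ Icc t₁ 0, 0 < w t ^ 2 + v t ^ 2) (hk₁ : 0 < k₁) (hρ : 0 < ρ)
    (hq₁ : ∀ t ∈ Icc t₁ 0, k₁ * w t ^ 2 ≤ w t * q t)
    (hq₀ : ∀ t ∈ Icc t₁ 0, -ρ ≤ w t → k₀ * w t ^ 2 ≤ w t * q t)
    (hc : ∀ t ∈ Icc t₁ (-1), 1 / 2 ≤ c t) (ht₁ : t₁ ≤ -1) {E : ℝ → ℝ}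
    (hE : ∀ t ∈ Icc t₁ 0, HasDerivAt E (-(a * c t * v t ^ 2)) t)
    (hEb : ∀ t ∈ Icc t₁ 0, |E t + κ * (v t * w t)| ≤ b)
    (hκ : 0 < κ) (hκ' : κ * (1 + a ^ 2 / (2 * k₁)) ≤ a / 2) :
    σ * (-1 - t₁) - 2 * (2 * (σ + a / 2) / (ρ ^ 2 * κ * k₁)) * b - a / 2 - Real.pi / 2 ≤
      phase a t₁ c q w v 0 := by
  -- `lam` times the decay of the Lyapunov function compensates the loss of speed when `w < -ρ`
  set lam := 2 * (σ + a / 2) / (ρ ^ 2 * κ * k₁) with hlam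
  have hlam0 : 0 < lam := by positivity
  have hq0 : ∀ t ∈ Icc t₁ 0, 0 ≤ w t * q t := fun t ht =>
    (mul_nonneg hk₁.le (sq_nonneg _)).trans (hq₁ t ht)
  have hsub : Icc t₁ (-1) ⊆ Icc t₁ 0 := Icc_subset_Icc_right (by norm_num)
  have hlate := h.phase_sub_mono hr (S := fun t => -(a / 2) * t) (S' := fun _ => -(a / 2))
    (s₁ := -1) (s₂ := 0) ht₁ (by norm_num) le_rfl
    (fun t _ => by simpa using (hasDerivAt_id t).const_mul (-(a / 2)))
    (fun t ht => h.neg_le_angularSpeed ha.le hr ⟨ht₁.trans ht.1, ht.2⟩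
      (hq0 t ⟨ht₁.trans ht.1, ht.2⟩))
  have hearly := h.phase_sub_mono hr
    (S := fun t => σ * t + lam * (E t + κ * (v t * w t)))
    (S' := fun t => σ + lam * (-(a * c t * v t ^ 2) +
      κ * ((-(a * c t * v t) - q t) * w t + v t * v t)))
    (s₁ := t₁) (s₂ := -1) le_rfl ht₁ (by norm_num)
    (fun t ht => by
      have ht' := hsub ht
      have h1 := (hE t ht').add (((h.deriv_v t ht').mul (h.deriv_w t ht')).const_mul κ)
      exact (((hasDerivAt_id t).const_mul σ).add (h1.const_mul lam)).congr_deriv (by simp))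
    (fun t ht => by
      have ht' := hsub ht
      have hcl := hc t ht
      have hc0 := h.c_nonneg t ht'
      have hc1 := h.c_le_one t ht'
      have hdecay : -(a * c t * v t ^ 2) + κ * ((-(a * c t * v t) - q t) * w t + v t * v t) ≤
          -(κ * k₁ / 2 * w t ^ 2) := by
        have h1 : a / 2 * v t ^ 2 ≤ a * c t * v t ^ 2 := by
          have := mul_le_mul_of_nonneg_left hcl (mul_nonneg ha.le (sq_nonneg (v t)))
          linarith
        have h2 : -(a * c t * v t * w t) ≤ k₁ / 2 * w t ^ 2 + a ^ 2 / (2 * k₁) * v t ^ 2 := by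
          have h3 : 0 ≤ (k₁ * w t + a * c t * v t) ^ 2 := sq_nonneg _
          have h4 : c t ^ 2 * v t ^ 2 ≤ v t ^ 2 := by
            have : c t ^ 2 ≤ 1 := by nlinarith
            nlinarith [sq_nonneg (v t)]
          have h5 : 0 ≤ k₁ ^ 2 * w t ^ 2 + 2 * k₁ * (a * c t * v t * w t) + a ^ 2 * v t ^ 2 := by
            nlinarith [sq_nonneg a]
          have h6 : k₁ / 2 * w t ^ 2 + a ^ 2 / (2 * k₁) * v t ^ 2 + a * c t * v t * w t =
              (k₁ ^ 2 * w t ^ 2 + 2 * k₁ * (a * c t * v t * w t) + a ^ 2 * v t ^ 2) /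
                (2 * k₁) := by
            field_simp
            ring
          have h7 := div_nonneg h5 (by positivity : 0 ≤ 2 * k₁)
          linarith
        have h8 := hq₁ t ht'
        have h9 := mul_le_mul_of_nonneg_left h2 hκ.le
        have h10 := mul_le_mul_of_nonneg_left h8 hκ.le
        have h11 := mul_le_mul_of_nonneg_right hκ' (sq_nonneg (v t))
        nlinarith
      have h1 := mul_le_mul_of_nonneg_left hdecay hlam0.le
      have h2 : lam * (κ * k₁ / 2 * w t ^ 2) = (σ + a / 2) * (w t ^ 2 / ρ ^ 2) := by
        rw [hlam]
        field_simp
      by_cases hwρ : -ρ ≤ w t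
      · have h3 := h.le_angularSpeed hσ hσ1 hr ht' (hq₀ t ht' hwρ)
        have h4 : 0 ≤ (σ + a / 2) * (w t ^ 2 / ρ ^ 2) := by positivity
        linarith
      · have h3 := h.neg_le_angularSpeed ha.le hr ht' (hq0 t ht')
        have h4 : 1 ≤ w t ^ 2 / ρ ^ 2 := by
          rw [one_le_div (by positivity)]
          nlinarith [not_le.mp hwρ]
        have h5 := mul_le_mul_of_nonneg_left h4 (by positivity : 0 ≤ σ + a / 2)
        linarith)
  have hstart : phase a t₁ c q w v t₁ = Real.arctan (v t₁ / -w t₁) := by simp [phase]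
  have h1 := Real.neg_pi_div_two_lt_arctan (v t₁ / -w t₁)
  have h2 := (abs_le.mp (hEb t₁ (left_mem_Icc.mpr h.neg.le))).2
  have h3 := (abs_le.mp (hEb (-1) ⟨ht₁, by norm_num⟩)).1
  have h4 := mul_le_mul_of_nonneg_left h2 hlam0.le
  have h5 := mul_le_mul_of_nonneg_left h3 hlam0.le
  rw [hstart] at hearly
  linarith

theorem phase_upper_bound (h : DampedOrbit a t₁ c q w v) (ha : 0 ≤ a) (hK : 0 ≤ K)
    (hr : ∀ t ∈ Icc t₁ 0, 0 < w t ^ 2 + v t ^ 2)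
    (hq : ∀ t ∈ Icc t₁ 0, w t * q t ≤ K * w t ^ 2) :
    phase a t₁ c q w v 0 ≤ Real.pi / 2 + (1 + a + K) * -t₁ := by
  have h1 := Real.arctan_lt_pi_div_two (v t₁ / -w t₁)
  have h2 : ∫ s in t₁..0, angularSpeed a c q w v s ≤ ∫ _ in t₁..0, (1 + a + K) := by
    refine intervalIntegral.integral_mono_on h.neg.le ?_ (by simp) fun t ht =>
      h.angularSpeed_le ha hK hr ht (hq t ht)
    refine ContinuousOn.intervalIntegrable ?_
    rw [uIcc_of_le h.neg.le]
    exact h.continuousOn_angularSpeed hr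
  rw [intervalIntegral.integral_const, smul_eq_mul] at h2
  rw [phase]
  linarith

end DampedOrbit

/-! ### The Emden–Fowler equation -/

/-- The positive zero of `y ↦ y ^ p - B y`. -/
noncomputable def equilibrium (B p : ℝ) : ℝ := B ^ (1 / (p - 1))

section Restoring

variable {B p : ℝ}

theorem equilibrium_pos (hB : 0 < B) : 0 < equilibrium B p := Real.rpow_pos_of_pos hB _

theorem equilibrium_rpow (hp : 1 < p) (hB : 0 < B) : equilibrium B p ^ (p - 1) = B := by
  rw [equilibrium, ← Real.rpow_mul hB.le, one_div_mul_cancel (by linarith), Real.rpow_one]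

theorem rpow_eq_rpow_sub_one_mul (hp : 1 < p) {y : ℝ} (hy : 0 ≤ y) : y ^ p = y ^ (p - 1) * y := by
  rcases hy.eq_or_lt with rfl | hy
  · rw [mul_zero, Real.zero_rpow (by linarith)]
  · rw [Real.rpow_sub_one hy.ne']
    field_simp

theorem restoring_equilibrium (hp : 1 < p) (hB : 0 < B) :
    equilibrium B p ^ p - B * equilibrium B p = 0 := by
  rw [rpow_eq_rpow_sub_one_mul hp (equilibrium_pos hB).le, equilibrium_rpow hp hB]
  ring

theorem convexOn_restoring (hp : 1 < p) : ConvexOn ℝ (Ici 0) fun y : ℝ => y ^ p - B * y := by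
  have h1 : ConcaveOn ℝ (Ici 0) fun y : ℝ => B * y :=
    (LinearMap.mul ℝ ℝ B).concaveOn (convex_Ici 0)
  exact (convexOn_rpow hp.le).sub h1

/-- By convexity the secant slope from the equilibrium at `y₁` bounds those further right. -/
theorem secant_le_restoring (hp : 1 < p) (hB : 0 < B) {y₁ y : ℝ} (h0 : 0 ≤ y₁)
    (h₁ : y₁ ≠ equilibrium B p) (hy : y₁ ≤ y) :
    (y₁ ^ p - B * y₁) / (y₁ - equilibrium B p) * (y - equilibrium B p) ^ 2 ≤
      (y - equilibrium B p) * (y ^ p - B * y) := by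
  by_cases hne : y = equilibrium B p
  · simp [hne]
  have h := (convexOn_restoring (B := B) hp).secant_mono (mem_Ici.mpr (equilibrium_pos hB).le)
    (mem_Ici.mpr h0) (mem_Ici.mpr (h0.trans hy)) h₁ hne hy
  simp only [restoring_equilibrium hp hB, sub_zero] at h
  have h2 := mul_le_mul_of_nonneg_right h (sq_nonneg (y - equilibrium B p))
  refine h2.trans (le_of_eq ?_)
  have : y - equilibrium B p ≠ 0 := sub_ne_zero.mpr hne
  field_simp

theorem restoring_le_secant (hp : 1 < p) (hB : 0 < B) {y₁ y : ℝ} (h0 : 0 ≤ y)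
    (h₁ : y₁ ≠ equilibrium B p) (hy : y ≤ y₁) :
    (y - equilibrium B p) * (y ^ p - B * y) ≤
      (y₁ ^ p - B * y₁) / (y₁ - equilibrium B p) * (y - equilibrium B p) ^ 2 := by
  by_cases hne : y = equilibrium B p
  · simp [hne]
  have h := (convexOn_restoring (B := B) hp).secant_mono (mem_Ici.mpr (equilibrium_pos hB).le)
    (mem_Ici.mpr h0) (mem_Ici.mpr (h0.trans hy)) hne h₁ hy
  simp only [restoring_equilibrium hp hB, sub_zero] at h
  have h2 := mul_le_mul_of_nonneg_right h (sq_nonneg (y - equilibrium B p))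
  refine (le_of_eq ?_).trans h2
  have : y - equilibrium B p ≠ 0 := sub_ne_zero.mpr hne
  field_simp

/-- Quantitative restoring force: a positive rate away from `0`, a rate close to the linearised
one `(p - 1) B` to the right of a point below the equilibrium, and an upper rate. -/
theorem exists_restoring_constants (hp : 1 < p) (hB : 0 < B) {k y₀ Y : ℝ}
    (hk : k < (p - 1) * B) (hy₀ : 0 < y₀) :
    (∃ k₁ > 0, ∀ y, y₀ ≤ y → k₁ * (y - equilibrium B p) ^ 2 ≤
      (y - equilibrium B p) * (y ^ p - B * y)) ∧
    (∃ k₀ > k, ∃ ρ > 0, ∀ y, 0 ≤ y → -ρ ≤ y - equilibrium B p →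
      k₀ * (y - equilibrium B p) ^ 2 ≤ (y - equilibrium B p) * (y ^ p - B * y)) ∧
    ∃ K ≥ 0, ∀ y, 0 ≤ y → y ≤ Y → |y ^ p - B * y| ≤ K * |y - equilibrium B p| ∧
      (y - equilibrium B p) * (y ^ p - B * y) ≤ K * (y - equilibrium B p) ^ 2 := by
  have hs := equilibrium_pos (p := p) hB
  set s := equilibrium B p with hsdef
  refine ⟨?_, ?_, ?_⟩
  · set y₁ := min y₀ (s / 2) with hy₁
    have h1 : 0 < y₁ := lt_min hy₀ (by linarith)
    have h2 : y₁ < s := (min_le_right _ _).trans_lt (by linarith)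
    refine ⟨(y₁ ^ p - B * y₁) / (y₁ - s), ?_, fun y hy =>
      secant_le_restoring hp hB h1.le h2.ne ((min_le_left _ _).trans hy)⟩
    refine div_pos_of_neg_of_neg ?_ (by linarith)
    have h3 : y₁ ^ (p - 1) < s ^ (p - 1) := Real.rpow_lt_rpow h1.le h2 (by linarith)
    rw [hsdef, equilibrium_rpow hp hB] at h3
    rw [rpow_eq_rpow_sub_one_mul hp h1.le]
    nlinarith
  · have hd : HasDerivAt (fun y : ℝ => y ^ p - B * y) ((p - 1) * B) s := by
      refine ((Real.hasDerivAt_rpow_const (x := s) (p := p) (Or.inr hp.le)).sub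
        ((hasDerivAt_id s).const_mul B)).congr_deriv ?_
      rw [hsdef, equilibrium_rpow hp hB]
      ring
    rw [hasDerivAt_iff_tendsto_slope] at hd
    have h1 : ∀ᶠ y in 𝓝[<] s, k < slope (fun y : ℝ => y ^ p - B * y) s y :=
      (hd.mono_left (nhdsWithin_mono _ fun y hy => (ne_of_lt hy : y ≠ s))).eventually
        (lt_mem_nhds hk)
    have h2 : ∀ᶠ y in 𝓝[<] s, y ∈ Ioo 0 s := Ioo_mem_nhdsLT hs
    obtain ⟨y₁, h3, h4⟩ := (h1.and h2).exists
    refine ⟨(y₁ ^ p - B * y₁) / (y₁ - s), ?_, s - y₁, by linarith [h4.2], fun y hy0 hy =>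
      secant_le_restoring hp hB h4.1.le h4.2.ne (by linarith)⟩
    rw [slope_def_field] at h3
    simpa only [hsdef, restoring_equilibrium hp hB, sub_zero] using h3
  · set y₁ := max Y (s + 1) with hy₁
    have h1 : s < y₁ := lt_max_of_lt_right (by linarith)
    have hK : 0 ≤ (y₁ ^ p - B * y₁) / (y₁ - s) := by
      refine div_nonneg ?_ (by linarith)
      have h3 : s ^ (p - 1) < y₁ ^ (p - 1) := Real.rpow_lt_rpow hs.le h1 (by linarith)
      rw [hsdef, equilibrium_rpow hp hB] at h3
      rw [rpow_eq_rpow_sub_one_mul hp (hs.trans h1).le]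
      nlinarith
    refine ⟨_, hK, fun y hy0 hy => ?_⟩
    have h2 := restoring_le_secant hp hB hy0 h1.ne' (hy.trans (le_max_left _ _))
    refine ⟨?_, h2⟩
    by_cases hne : y = s
    · rw [hne, hsdef, restoring_equilibrium hp hB]
      simp
    have h3 := secant_le_restoring (y₁ := 0) (y := y) hp hB le_rfl hs.ne hy0
    rw [Real.zero_rpow (by linarith), mul_zero, sub_zero, zero_div, zero_mul] at h3
    have h4 : 0 < |y - s| := abs_pos.mpr (sub_ne_zero.mpr hne)
    refine le_of_mul_le_mul_left ?_ h4
    rw [← abs_mul, abs_of_nonneg h3]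
    refine h2.trans (le_of_eq ?_)
    rw [← sq_abs (y - s)]
    ring

end Restoring

/-- The energy of the equation `y'' + a c(t) y' - B y + y ^ p = 0`. -/
noncomputable def emdenEnergy (B p y v : ℝ) : ℝ :=
  v ^ 2 / 2 - B * y ^ 2 / 2 + y ^ (p + 1) / (p + 1)

/-- A solution of `y'' + a c(t) y' - B y + y ^ p = 0` on `[t₁, 0]` that starts below the
equilibrium with energy at most `-η`. The equation is only assumed where `y` is positive. -/
structure EmdenOrbit (a B p η t₁ : ℝ) (c y v : ℝ → ℝ) : Prop where
  neg : t₁ < 0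
  cont_c : Continuous c
  cont_y : Continuous y
  cont_v : Continuous v
  deriv_y : ∀ t ∈ Icc t₁ 0, HasDerivAt y (v t) t
  deriv_v : ∀ t ∈ Icc t₁ 0, 0 < y t →
    HasDerivAt v (-(a * c t * v t) - (y t ^ p - B * y t)) t
  c_nonneg : ∀ t ∈ Icc t₁ 0, 0 ≤ c t
  c_le_one : ∀ t ∈ Icc t₁ 0, c t ≤ 1
  half_le_c : ∀ t ∈ Icc t₁ (-1), 1 / 2 ≤ c t
  start_pos : 0 < y t₁
  start_lt : y t₁ < equilibrium B p
  start_energy : emdenEnergy B p (y t₁) (v t₁) ≤ -η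

namespace EmdenOrbit

variable {a B p η t₁ : ℝ} {c y v : ℝ → ℝ}

theorem hasDerivAt_energy (h : EmdenOrbit a B p η t₁ c y v) (hp : 1 < p) {t : ℝ}
    (ht : t ∈ Icc t₁ 0) (hy : 0 < y t) :
    HasDerivAt (fun t => emdenEnergy B p (y t) (v t)) (-(a * c t * v t ^ 2)) t := by
  have h1 := h.deriv_y t ht
  have h2 := h.deriv_v t ht hy
  have h3 := h1.rpow_const (p := p + 1) (Or.inl hy.ne')
  refine ((((h2.pow 2).div_const 2).sub (((h1.pow 2).const_mul B).div_const 2)).add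
    (h3.div_const (p + 1))).congr_deriv ?_
  have : p + 1 ≠ 0 := by linarith
  rw [add_sub_cancel_right]
  field_simp
  norm_num
  ring

theorem continuous_energy (h : EmdenOrbit a B p η t₁ c y v) (hp : 1 < p) :
    Continuous fun t => emdenEnergy B p (y t) (v t) := by
  have h1 := h.cont_y
  have h2 := h.cont_v
  have h3 : Continuous fun t => y t ^ (p + 1) :=
    h1.rpow_const fun _ => Or.inr (by linarith)
  unfold emdenEnergy
  fun_prop

theorem energy_le_of_prefix (h : EmdenOrbit a B p η t₁ c y v) (ha : 0 ≤ a) (hp : 1 < p) {s : ℝ}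
    (hs : s ∈ Icc t₁ 0) (hpre : ∀ t ∈ Ioo t₁ s, 0 < y t) :
    emdenEnergy B p (y s) (v s) ≤ -η := by
  have hsub : Ioo t₁ s ⊆ Icc t₁ 0 := fun t ht => ⟨ht.1.le, ht.2.le.trans hs.2⟩
  have hanti : AntitoneOn (fun t => emdenEnergy B p (y t) (v t)) (Icc t₁ s) := by
    refine antitoneOn_of_deriv_nonpos (convex_Icc _ _) (h.continuous_energy hp).continuousOn ?_ ?_
    · rw [interior_Icc]
      exact fun t ht => (h.hasDerivAt_energy hp (hsub ht)
        (hpre t ht)).differentiableAt.differentiableWithinAt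
    · rw [interior_Icc]
      intro t ht
      rw [(h.hasDerivAt_energy hp (hsub ht) (hpre t ht)).deriv]
      have := mul_nonneg (mul_nonneg ha (h.c_nonneg t (hsub ht))) (sq_nonneg (v t))
      linarith
  exact (hanti (left_mem_Icc.mpr hs.1) (right_mem_Icc.mpr hs.1) hs.1).trans h.start_energy

/-- The energy vanishes or is positive at a zero of `y`, so negative energy forces positivity. -/
theorem pos (h : EmdenOrbit a B p η t₁ c y v) (ha : 0 ≤ a) (hp : 1 < p) (hη : 0 < η) :
    ∀ t ∈ Icc t₁ 0, 0 < y t := by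
  refine pos_of_forall_prefix h.cont_y.continuousOn h.start_pos fun s hs hpre h0 => ?_
  have h1 := h.energy_le_of_prefix ha hp ⟨hs.1.le, hs.2⟩ fun t ht => hpre t ⟨ht.1.le, ht.2⟩
  rw [emdenEnergy, h0, Real.zero_rpow (by linarith)] at h1
  have := sq_nonneg (v s)
  norm_num at h1
  linarith

theorem energy_le (h : EmdenOrbit a B p η t₁ c y v) (ha : 0 ≤ a) (hp : 1 < p) (hη : 0 < η)
    {t : ℝ} (ht : t ∈ Icc t₁ 0) : emdenEnergy B p (y t) (v t) ≤ -η :=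
  h.energy_le_of_prefix ha hp ht fun s hs => h.pos ha hp hη s ⟨hs.1.le, hs.2.le.trans ht.2⟩

end EmdenOrbit

/-- Points of negative energy form a bounded set that stays away from `y = 0`. -/
theorem bounds_of_emdenEnergy_le {B p η y v : ℝ} (hp : 1 < p) (hB : 0 < B) (hη : 0 < η)
    (hy : 0 < y) (hE : emdenEnergy B p y v ≤ -η) :
    √(2 * η / B) ≤ y ∧ y ≤ ((p + 1) * B / 2) ^ (1 / (p - 1)) ∧ v ^ 2 ≤ B * y ^ 2 ∧
      |emdenEnergy B p y v| ≤ B * y ^ 2 / 2 := by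
  have h1 : 0 < y ^ (p + 1) / (p + 1) := div_pos (Real.rpow_pos_of_pos hy _) (by linarith)
  have h2 := sq_nonneg v
  have hE' := hE
  rw [emdenEnergy] at hE
  refine ⟨?_, ?_, by linarith, ?_⟩
  · rw [Real.sqrt_le_left hy.le, div_le_iff₀ hB]
    linarith
  · have h3 : y ^ (p + 1) = y ^ (p - 1) * y ^ 2 := by
      rw [← Real.rpow_natCast, ← Real.rpow_add hy]
      congr 1
      norm_num
      ring
    have h4 : y ^ (p - 1) ≤ (p + 1) * B / 2 := by
      have h5 : y ^ (p - 1) * y ^ 2 / (p + 1) < B * y ^ 2 / 2 := by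
        rw [← h3]
        linarith
      rw [div_lt_iff₀ (by linarith)] at h5
      have h6 : 0 < y ^ 2 := by positivity
      by_contra! h7
      nlinarith
    calc y = (y ^ (p - 1)) ^ (1 / (p - 1)) := by
          rw [← Real.rpow_mul hy.le, mul_one_div_cancel (by linarith), Real.rpow_one]
      _ ≤ _ := Real.rpow_le_rpow (Real.rpow_nonneg hy.le _) h4
          (one_div_nonneg.mpr (by linarith))
  · rw [abs_of_nonpos (by linarith), emdenEnergy]
    linarith

/-- Orbits of energy at most `-η` wind around the equilibrium, uniformly: the total phase is
bounded above and below by affine functions of the elapsed time. The hypothesis says that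
the linearisation at the equilibrium is oscillatory. -/
theorem exists_phase_bounds {a B p η : ℝ} (ha : 0 < a) (hB : 0 < B) (hp : 1 < p) (hη : 0 < η)
    (hosc : a ^ 2 / 4 < (p - 1) * B) :
    ∃ σ > 0, ∃ C K : ℝ, ∀ t₁ c y v, EmdenOrbit a B p η t₁ c y v →
      DampedOrbit a t₁ c (fun t => y t ^ p - B * y t) (fun t => y t - equilibrium B p) v ∧
      (∀ t ∈ Icc t₁ 0, 0 < (y t - equilibrium B p) ^ 2 + v t ^ 2) ∧
      phase a t₁ c (fun t => y t ^ p - B * y t) (fun t => y t - equilibrium B p) v 0 ≤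
        Real.pi / 2 + K * -t₁ ∧
      (t₁ ≤ -1 → σ * -t₁ - C ≤
        phase a t₁ c (fun t => y t ^ p - B * y t) (fun t => y t - equilibrium B p) v 0) := by
  set y₀ := √(2 * η / B) with hy₀def
  set Y := ((p + 1) * B / 2) ^ (1 / (p - 1)) with hY
  have hy₀ : 0 < y₀ := Real.sqrt_pos.mpr (by positivity)
  have hY0 : 0 < Y := Real.rpow_pos_of_pos (by positivity) _
  obtain ⟨⟨k₁, hk₁, hq₁⟩, ⟨k₀, hk₀, ρ, hρ, hq₀⟩, K, hK, hqK⟩ :=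
    exists_restoring_constants hp hB (Y := Y) hosc hy₀
  have hs := equilibrium_pos (p := p) hB
  set s := equilibrium B p with hsdef
  -- the rate solves `a² ≤ 4 (1 - σ) (k₀ - σ)`
  set σ := min (1 / 2) ((k₀ - a ^ 2 / 4) / (1 + k₀)) with hσ
  have hk₀0 : 0 < k₀ := (by positivity : 0 ≤ a ^ 2 / 4).trans_lt hk₀
  have hσ0 : 0 < σ := lt_min (by norm_num) (div_pos (by linarith) (by linarith))
  have hσ1 : σ < 1 := (min_le_left _ _).trans_lt (by norm_num)
  have hσ2 : a ^ 2 ≤ 4 * ((1 - σ) * (k₀ - σ)) := by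
    have h1 : σ ≤ (k₀ - a ^ 2 / 4) / (1 + k₀) := min_le_right _ _
    rw [le_div_iff₀ (by linarith)] at h1
    nlinarith [sq_nonneg σ]
  -- small enough for `E + κ v w` to be nonincreasing while `c ≥ 1 / 2`
  set κ := a / 2 / (1 + a ^ 2 / (2 * k₁)) with hκ
  have hκ0 : 0 < κ := by positivity
  have hκ1 : κ * (1 + a ^ 2 / (2 * k₁)) ≤ a / 2 := by
    rw [hκ, div_mul_cancel₀ _ (by positivity)]
  -- a bound for the Lyapunov function in the region `y ≤ Y`, `v² ≤ B y²`
  set b := B * Y ^ 2 / 2 + κ * (√B * Y * (Y + s)) with hb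
  refine ⟨σ, hσ0, σ + 2 * (2 * (σ + a / 2) / (ρ ^ 2 * κ * k₁)) * b + a / 2 + Real.pi / 2,
    1 + a + K, fun t₁ c y v h => ?_⟩
  have hpos := h.pos ha.le hp hη
  have hbd := fun t ht => bounds_of_emdenEnergy_le hp hB hη (hpos t ht) (h.energy_le ha.le hp hη ht)
  have hD : DampedOrbit a t₁ c (fun t => y t ^ p - B * y t) (fun t => y t - s) v :=
    { neg := h.neg
      cont_c := h.cont_c
      cont_q := (h.cont_y.rpow_const fun _ => Or.inr (by linarith)).sub
        (continuous_const.mul h.cont_y)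
      deriv_w := fun t ht => (h.deriv_y t ht).sub_const s
      deriv_v := fun t ht => h.deriv_v t ht (hpos t ht)
      c_nonneg := h.c_nonneg
      c_le_one := h.c_le_one
      start_neg := sub_neg.mpr h.start_lt }
  have hr : ∀ t ∈ Icc t₁ 0, 0 < (y t - s) ^ 2 + v t ^ 2 := fun t ht =>
    hD.radius_pos ha.le (K := K) (fun t ht => (hqK _ (hpos t ht).le (hbd t ht).2.1).1) ht
  refine ⟨hD, hr, hD.phase_upper_bound ha.le hK hr fun t ht =>
    (hqK _ (hpos t ht).le (hbd t ht).2.1).2, fun ht₁ => ?_⟩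
  have := hD.phase_lower_bound ha hσ0 hσ2 hσ1 hr hk₁ hρ (b := b) (κ := κ)
    (fun t ht => hq₁ _ (hbd t ht).1) (fun t ht => hq₀ _ (hpos t ht).le) h.half_le_c ht₁
    (fun t ht => h.hasDerivAt_energy hp ht (hpos t ht))
    (fun t ht => by
      obtain ⟨-, h2, h3, h4⟩ := hbd t ht
      have hy := hpos t ht
      have h5 : y t ^ 2 ≤ Y ^ 2 := by gcongr
      have h6 : |v t| ≤ √B * Y := by
        refine abs_le_of_sq_le_sq ?_ (by positivity)
        rw [mul_pow, Real.sq_sqrt hB.le]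
        nlinarith
      have h7 : |y t - s| ≤ Y + s := by
        rw [abs_le]
        constructor <;> linarith
      calc |emdenEnergy B p (y t) (v t) + κ * (v t * (y t - s))|
          ≤ |emdenEnergy B p (y t) (v t)| + |κ * (v t * (y t - s))| := abs_add_le _ _
        _ ≤ b := by
          rw [abs_mul, abs_mul, abs_of_pos hκ0, hb]
          have : B * y t ^ 2 / 2 ≤ B * Y ^ 2 / 2 := by gcongr
          have : |v t| * |y t - s| ≤ √B * Y * (Y + s) := by gcongr
          have := mul_le_mul_of_nonneg_left this hκ0.le
          linarith) hκ0 hκ1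
  linarith

/-! ### Emden–Fowler variables -/

/-- The coordinate `z = 1 - cos θ` on the sphere as a function of the Emden–Fowler time
`t = log tan (θ / 2)`, that is `z = 1 + tanh t`; the equator is `t = 0`. -/
noncomputable def poleCoord (t : ℝ) : ℝ := 2 / (1 + Real.exp (-2 * t))

theorem poleCoord_pos (t : ℝ) : 0 < poleCoord t := by
  unfold poleCoord; positivity

theorem poleCoord_lt_two (t : ℝ) : poleCoord t < 2 := by
  unfold poleCoord
  rw [div_lt_iff₀ (by positivity)]
  linarith [Real.exp_pos (-2 * t)]

theorem poleCoord_zero : poleCoord 0 = 1 := by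
  norm_num [poleCoord]

theorem hasDerivAt_poleCoord (t : ℝ) :
    HasDerivAt poleCoord (poleCoord t * (2 - poleCoord t)) t := by
  have h1 : HasDerivAt (fun t : ℝ => 1 + Real.exp (-2 * t)) (Real.exp (-2 * t) * (-2 * 1)) t :=
    ((hasDerivAt_id t).const_mul (-2)).exp.const_add 1
  have h2 : (1 + Real.exp (-2 * t)) ≠ 0 := by positivity
  refine ((hasDerivAt_const t (2 : ℝ)).div h1 h2).congr_deriv ?_
  unfold poleCoord
  field_simp
  ring

@[fun_prop]
theorem continuous_poleCoord : Continuous poleCoord :=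
  continuous_iff_continuousAt.mpr fun t => (hasDerivAt_poleCoord t).continuousAt

theorem poleCoord_monotone : Monotone poleCoord := by
  intro s t hst
  unfold poleCoord
  have : Real.exp (-2 * t) ≤ Real.exp (-2 * s) := Real.exp_le_exp.mpr (by linarith)
  gcongr

theorem poleCoord_le_one {t : ℝ} (ht : t ≤ 0) : poleCoord t ≤ 1 :=
  poleCoord_zero ▸ poleCoord_monotone ht

theorem poleCoord_le_half {t : ℝ} (ht : t ≤ -1) : poleCoord t ≤ 1 / 2 := by
  unfold poleCoord
  rw [div_le_div_iff₀ (by positivity) (by norm_num)]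
  have := Real.add_one_le_exp (-2 * t)
  linarith

/-- `sin θ ^ m` as a function of the Emden–Fowler time. -/
noncomputable def sinPow (m t : ℝ) : ℝ := (poleCoord t * (2 - poleCoord t)) ^ (m / 2)

theorem sinSq_pos (t : ℝ) : 0 < poleCoord t * (2 - poleCoord t) :=
  mul_pos (poleCoord_pos t) (by linarith [poleCoord_lt_two t])

theorem sinPow_pos (m t : ℝ) : 0 < sinPow m t := Real.rpow_pos_of_pos (sinSq_pos t) _

theorem hasDerivAt_sinPow (m t : ℝ) :
    HasDerivAt (sinPow m) (m * (1 - poleCoord t) * sinPow m t) t := by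
  have h0 := hasDerivAt_poleCoord t
  have h1 := (h0.mul (h0.const_sub 2)).rpow_const (p := m / 2) (Or.inl (sinSq_pos t).ne')
  refine h1.congr_deriv ?_
  simp only [Pi.mul_apply]
  rw [Real.rpow_sub_one (sinSq_pos t).ne', sinPow]
  have := (poleCoord_pos t).ne'
  have : 2 - poleCoord t ≠ 0 := by linarith [poleCoord_lt_two t]
  field_simp
  ring

theorem continuous_sinPow (m : ℝ) : Continuous (sinPow m) :=
  continuous_iff_continuousAt.mpr fun t => (hasDerivAt_sinPow m t).continuousAt

theorem sinPow_rpow {m p : ℝ} (hmp : (p - 1) * m = 2) (t : ℝ) :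
    sinPow m t ^ (p - 1) = poleCoord t * (2 - poleCoord t) := by
  rw [sinPow, ← Real.rpow_mul (sinSq_pos t).le, show m / 2 * (p - 1) = 1 by linarith, Real.rpow_one]

/-- The Emden–Fowler transform `y = sin θ ^ m g` of a function `g` of `z = 1 - cos θ`. -/
noncomputable def emdenValue (m : ℝ) (g : ℝ → ℝ) (t : ℝ) : ℝ := sinPow m t * g (poleCoord t)

/-- The derivative of `emdenValue m g`, where `h` is the derivative of `g`. -/
noncomputable def emdenVelocity (m : ℝ) (g h : ℝ → ℝ) (t : ℝ) : ℝ :=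
  sinPow m t * (m * (1 - poleCoord t) * g (poleCoord t) +
    poleCoord t * (2 - poleCoord t) * h (poleCoord t))

theorem hasDerivAt_emdenValue {m : ℝ} {g h : ℝ → ℝ} {t : ℝ}
    (hg : HasDerivAt g (h (poleCoord t)) (poleCoord t)) :
    HasDerivAt (emdenValue m g) (emdenVelocity m g h t) t := by
  refine ((hasDerivAt_sinPow m t).mul (hg.comp t (hasDerivAt_poleCoord t))).congr_deriv ?_
  simp only [emdenVelocity, Function.comp_apply]
  ring

/-- In the Emden–Fowler variables the equation on the sphere becomes
`y'' + a (1 - z) y' - m (a + m) y + y ^ p = 0`, whose only non-autonomous term is the damping. -/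
theorem hasDerivAt_emdenVelocity {a m p : ℝ} (hp : 1 < p) (hmp : (p - 1) * m = 2)
    {g h : ℝ → ℝ} {h' t : ℝ} (hg : HasDerivAt g (h (poleCoord t)) (poleCoord t))
    (hh : HasDerivAt h h' (poleCoord t)) (hpos : 0 < g (poleCoord t))
    (hode : poleCoord t * (2 - poleCoord t) * h' +
      (a + 2 + 2 * m) * (1 - poleCoord t) * h (poleCoord t) =
      m * (a + 1 + m) * g (poleCoord t) - g (poleCoord t) ^ p) :
    HasDerivAt (emdenVelocity m g h) (-(a * (1 - poleCoord t) * emdenVelocity m g h t) -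
      (emdenValue m g t ^ p - m * (a + m) * emdenValue m g t)) t := by
  have hz := hasDerivAt_poleCoord t
  have hg' := hg.comp t hz
  have hh' := hh.comp t hz
  have h1 := (hasDerivAt_sinPow m t).mul ((((hz.const_sub 1).const_mul m).mul hg').add
    ((hz.mul (hz.const_sub 2)).mul hh'))
  refine h1.congr_deriv ?_
  have hS := sinPow_pos m t
  have hpow : emdenValue m g t ^ p =
      sinPow m t * (poleCoord t * (2 - poleCoord t)) * g (poleCoord t) ^ p := by
    rw [emdenValue, Real.mul_rpow hS.le hpos.le, rpow_eq_rpow_sub_one_mul hp hS.le,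
      sinPow_rpow hmp]
    ring
  rw [hpow]
  simp only [emdenVelocity, emdenValue, Pi.mul_apply, Pi.add_apply, Function.comp_apply]
  linear_combination (sinPow m t * (poleCoord t * (2 - poleCoord t))) * hode

/-- The time at which `poleCoord` equals `κ / α ^ (p - 1)`. -/
noncomputable def startTime (p κ α : ℝ) : ℝ := -(Real.log (2 * α ^ (p - 1) / κ - 1) / 2)

section StartTime

variable {p κ α : ℝ}

theorem three_le_startTime_arg (hp : 1 < p) (hκ : 0 < κ) (hκ1 : κ ≤ 1 / 2) (hα : 1 ≤ α) :
    3 ≤ 2 * α ^ (p - 1) / κ - 1 := by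
  have h1 : 1 ≤ α ^ (p - 1) := Real.one_le_rpow hα (by linarith)
  have h2 : 4 ≤ 2 * α ^ (p - 1) / κ := by
    rw [le_div_iff₀ hκ]
    nlinarith
  linarith

theorem startTime_neg (hp : 1 < p) (hκ : 0 < κ) (hκ1 : κ ≤ 1 / 2) (hα : 1 ≤ α) :
    startTime p κ α < 0 := by
  have := Real.log_pos (by linarith [three_le_startTime_arg hp hκ hκ1 hα] :
    1 < 2 * α ^ (p - 1) / κ - 1)
  rw [startTime]
  linarith

theorem poleCoord_startTime (hp : 1 < p) (hκ : 0 < κ) (hκ1 : κ ≤ 1 / 2) (hα : 1 ≤ α) :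
    poleCoord (startTime p κ α) = κ / α ^ (p - 1) := by
  have h1 := three_le_startTime_arg hp hκ hκ1 hα
  have h2 : 0 < α ^ (p - 1) := Real.rpow_pos_of_pos (by linarith) _
  rw [poleCoord, startTime, show -2 * -(Real.log (2 * α ^ (p - 1) / κ - 1) / 2) =
    Real.log (2 * α ^ (p - 1) / κ - 1) by ring, Real.exp_log (by linarith)]
  field_simp
  ring

theorem continuousOn_startTime (hp : 1 < p) (hκ : 0 < κ) (hκ1 : κ ≤ 1 / 2) :
    ContinuousOn (startTime p κ) (Ici 1) := by
  unfold startTime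
  have h1 : Continuous fun α : ℝ => α ^ (p - 1) :=
    continuous_id.rpow_const fun _ => Or.inr (by linarith)
  refine ((ContinuousOn.log (by fun_prop) fun α hα => ?_).div_const 2).neg
  linarith [three_le_startTime_arg hp hκ hκ1 hα]

theorem tendsto_neg_startTime (hp : 1 < p) (hκ : 0 < κ) :
    Tendsto (fun α => -startTime p κ α) atTop atTop := by
  have h1 : Tendsto (fun α : ℝ => 2 * α ^ (p - 1) / κ - 1) atTop atTop :=
    tendsto_atTop_add_const_right _ _ (((tendsto_rpow_atTop (by linarith)).const_mul_atTop
      (by norm_num : (0 : ℝ) < 2)).atTop_div_const hκ)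
  have h2 := (Real.tendsto_log_atTop.comp h1).atTop_div_const (by norm_num : (0 : ℝ) < 2)
  refine h2.congr fun α => ?_
  simp [startTime]

end StartTime

/-- Continuity of an integral over a moving interval whose integrand is only continuous on the
region of integration. -/
theorem continuousOn_integral_moving {S : Set ℝ} {τ : ℝ → ℝ} {f : ℝ → ℝ → ℝ}
    (hτ : ContinuousOn τ S) (hτ0 : ∀ α ∈ S, τ α ≤ 0)
    (hf : ContinuousOn (fun q : ℝ × ℝ => f q.1 q.2) {q | q.1 ∈ S ∧ q.2 ∈ Icc (τ q.1) 0}) :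
    ContinuousOn (fun α => ∫ t in τ α..0, f α t) S := by
  have hτ' : Continuous fun α : S => τ α := hτ.comp_continuous continuous_subtype_val Subtype.prop
  have hmap : Continuous fun q : S × ℝ => ((q.1 : ℝ), τ q.1 * clampUnit q.2) := by
    have := hτ'.comp (continuous_fst : Continuous fun q : S × ℝ => q.1)
    exact (continuous_subtype_val.comp continuous_fst).prodMk
      (this.mul (continuous_clampUnit.comp continuous_snd))
  have hc := hf.comp_continuous hmap fun q => by
    have h1 := clampUnit_mem q.2
    have h2 := hτ0 q.1 q.1.2
    exact ⟨q.1.2, by nlinarith [h1.1, h1.2], mul_nonpos_of_nonpos_of_nonneg h2 h1.1⟩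
  have hint := intervalIntegral.continuous_parametric_intervalIntegral_of_continuous'
    (μ := MeasureTheory.volume)
    (f := fun (α : S) u => f α (τ α * clampUnit u)) hc 0 1
  rw [← continuousOn_univ] at hint
  have hfin : Continuous fun α : S => ∫ t in τ α..0, f α t := by
    refine (hτ'.mul (continuousOn_univ.mp hint)).neg.congr fun α => ?_
    have h1 := intervalIntegral.mul_integral_comp_mul_left (a := 0) (b := 1) (f := f α) (τ α)
    rw [mul_zero, mul_one] at h1
    rw [intervalIntegral.integral_symm, ← h1]
    refine congrArg (fun x => -(τ α * x)) (intervalIntegral.integral_congr fun u hu => ?_)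
    rw [uIcc_of_le zero_le_one] at hu
    simp only [clampUnit_of_mem hu]
  exact continuousOn_iff_continuous_domRestrict.mpr hfin

/-! ### Solutions on the hemisphere -/

/-- Regular solutions starting at a large `α` give Emden orbits of uniformly negative energy:
at the start the slope of `g` is dominated by `g`, so `y'² ≤ m² y² = (B - m a) y²`, while `y` is
small but of a size independent of `α`. -/
theorem emdenOrbit_of_regular {a m p κ α : ℝ} (ha : 0 < a) (hm : 0 < m) (hp : 1 < p)
    (hmp : (p - 1) * m = 2) (hκ : 0 < κ) (hκ1 : κ ≤ 1 / 2)
    (hκ2 : 2 ^ ((a + 2 + 2 * m) / 2 - 1) * κ ≤ 1 / 4)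
    (hκ3 : 2 ^ ((a + 2 + 2 * m) / 2 - 1) * κ ≤ m / 4)
    (hκ4 : 2 * κ ≤ m * a * (p + 1) / 4) (hκ5 : 2 * κ < m * (a + m))
    (hα : 1 ≤ α) (hμ : m * (a + 1 + m) ≤ (α / 2) ^ (p - 1)) {F g : ℝ → ℝ} (hF : ContDiff ℝ 1 F)
    (hFeq : ∀ x ∈ Icc 0 α, F x = m * (a + 1 + m) * x - x ^ p)
    (hg : ∀ z, HasDerivAt g (regularSlope ((a + 2 + 2 * m) / 2) F g z) z) (hg0 : g 0 = α)
    (hle : ∀ z ∈ Icc (0 : ℝ) 1, g z ≤ α) :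
    (∀ z ∈ Icc 0 (κ / α ^ (p - 1)), 0 < g z) ∧
    EmdenOrbit a (m * (a + m)) p (m * a / 4 * ((κ / 2 ^ (p - 1)) ^ (1 / (p - 1))) ^ 2)
      (startTime p κ α) (fun t => 1 - poleCoord t) (emdenValue m g)
      (emdenVelocity m g (regularSlope ((a + 2 + 2 * m) / 2) F g)) := by
  set ν := (a + 2 + 2 * m) / 2 with hνdef
  have hν : 1 ≤ ν := by rw [hνdef]; linarith
  set h := regularSlope ν F g with hh
  have hα0 : 0 < α := by linarith
  have hgc : Continuous g := continuous_iff_continuousAt.mpr fun z => (hg z).continuousAt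
  have hhc : Continuous h := continuous_regularSlope hν hF.continuous hgc
  have hS := continuous_sinPow m
  set t₁ := startTime p κ α with ht₁
  have ht₁0 : t₁ < 0 := startTime_neg hp hκ hκ1 hα
  have hα1 : 1 ≤ α ^ (p - 1) := Real.one_le_rpow hα (by linarith)
  have hαp : α ^ p = α ^ (p - 1) * α := rpow_eq_rpow_sub_one_mul hp hα0.le
  set z₁ := κ / α ^ (p - 1) with hz₁
  have hzt : poleCoord t₁ = z₁ := poleCoord_startTime hp hκ hκ1 hα
  have hz₁α : z₁ * α ^ (p - 1) = κ := div_mul_cancel₀ _ (by positivity)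
  have hz₁0 : 0 < z₁ := by positivity
  have hz₁1 : z₁ ≤ 1 := by
    rw [hz₁, div_le_one (by positivity)]
    linarith
  have hμ0 : 0 ≤ m * (a + 1 + m) := by positivity
  have hnear := fun z (hz : z ∈ Icc 0 z₁) => regular_solution_near_pole hν hμ0 hp hα0 hFeq hg hg0
    hle hμ ⟨hz₁0.le, hz₁1⟩
    (by
      rw [hαp]
      calc 2 ^ (ν - 1) * (α ^ (p - 1) * α) * z₁ = 2 ^ (ν - 1) * (z₁ * α ^ (p - 1)) * α := by ring
        _ ≤ α / 4 := by
          rw [hz₁α]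
          nlinarith) hz
  obtain ⟨hg1, hh1, hh2⟩ := hnear z₁ ⟨hz₁0.le, le_rfl⟩
  have hg1' : g z₁ ≤ α := hle z₁ ⟨hz₁0.le, hz₁1⟩
  have hg10 : 0 < g z₁ := by linarith
  have hSp := sinPow_pos m t₁
  have hy1 : emdenValue m g t₁ = sinPow m t₁ * g z₁ := by rw [emdenValue, hzt]
  have hypos : 0 < emdenValue m g t₁ := by rw [hy1]; positivity
  have hypow : emdenValue m g t₁ ^ (p - 1) = z₁ * (2 - z₁) * g z₁ ^ (p - 1) := by
    rw [hy1, Real.mul_rpow hSp.le hg10.le, sinPow_rpow hmp, hzt]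
  have hgpow : g z₁ ^ (p - 1) ≤ α ^ (p - 1) := Real.rpow_le_rpow hg10.le hg1' (by linarith)
  have hgpow0 : 0 < g z₁ ^ (p - 1) := Real.rpow_pos_of_pos hg10 _
  have hyup : emdenValue m g t₁ ^ (p - 1) ≤ 2 * κ := by
    rw [hypow]
    calc z₁ * (2 - z₁) * g z₁ ^ (p - 1) ≤ z₁ * 2 * α ^ (p - 1) := by
          gcongr
          linarith
      _ = 2 * κ := by rw [← hz₁α]; ring
  have hylow : κ / 2 ^ (p - 1) ≤ emdenValue m g t₁ ^ (p - 1) := by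
    rw [hypow]
    have h1 : (α / 2) ^ (p - 1) ≤ g z₁ ^ (p - 1) :=
      Real.rpow_le_rpow (by positivity) hg1.le (by linarith)
    rw [Real.div_rpow hα0.le (by norm_num)] at h1
    calc κ / 2 ^ (p - 1) = z₁ * 1 * (α ^ (p - 1) / 2 ^ (p - 1)) := by rw [← hz₁α]; ring
      _ ≤ z₁ * (2 - z₁) * g z₁ ^ (p - 1) :=
        mul_le_mul (mul_le_mul_of_nonneg_left (by linarith) hz₁0.le) h1 (by positivity)
          (mul_nonneg hz₁0.le (by linarith))
  have hroot : ∀ x : ℝ, 0 ≤ x → (x ^ (p - 1)) ^ (1 / (p - 1)) = x := fun x hx => by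
    rw [← Real.rpow_mul hx, mul_one_div_cancel (by linarith), Real.rpow_one]
  have hylow' : (κ / 2 ^ (p - 1)) ^ (1 / (p - 1)) ≤ emdenValue m g t₁ := by
    rw [← hroot _ hypos.le]
    exact Real.rpow_le_rpow (by positivity) hylow (one_div_nonneg.mpr (by linarith))
  refine ⟨fun z hz => by linarith [(hnear z hz).1], ?_⟩
  exact {
    neg := ht₁0
    cont_c := by fun_prop
    cont_y := by
      unfold emdenValue
      fun_prop
    cont_v := by
      unfold emdenVelocity
      fun_prop
    deriv_y := fun t _ => hasDerivAt_emdenValue (hg _)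
    deriv_v := fun t ht hy => by
      have hz0 := poleCoord_pos t
      have hz1 := poleCoord_le_one ht.2
      have hgpos : 0 < g (poleCoord t) := pos_of_mul_pos_right hy (sinPow_pos m t).le
      refine hasDerivAt_emdenVelocity hp hmp (hg _)
        (hasDerivAt_regularSlope hν hF hg ⟨by linarith, by linarith⟩) hgpos ?_
      rw [← hFeq _ ⟨hgpos.le, hle _ ⟨hz0.le, hz1⟩⟩,
        ← regularSlope_ode hν hF hg ⟨hz0.le, by linarith⟩, hνdef]
      ring
    c_nonneg := fun t ht => by linarith [poleCoord_le_one ht.2]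
    c_le_one := fun t _ => by linarith [poleCoord_pos t]
    half_le_c := fun t ht => by linarith [poleCoord_le_half ht.2]
    start_pos := hypos
    start_lt := by
      rw [← hroot _ hypos.le, equilibrium]
      exact Real.rpow_lt_rpow (by positivity) (by linarith) (one_div_pos.mpr (by linarith))
    start_energy := by
      -- `|m (1 - z₁) g + z₁ (2 - z₁) g'| ≤ m g` at `z₁`
      have hX : |m * (1 - z₁) * g z₁ + z₁ * (2 - z₁) * h z₁| ≤ m * g z₁ := by
        have h1 : 0 ≤ z₁ * (2 - z₁) := mul_nonneg hz₁0.le (by linarith)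
        have h2 : -(m * g z₁) ≤ z₁ * (2 - z₁) * h z₁ := by
          have h3 : z₁ * (2 - z₁) * (2 ^ (ν - 1) * α ^ p) ≤ m * α / 2 := by
            rw [hαp]
            calc z₁ * (2 - z₁) * (2 ^ (ν - 1) * (α ^ (p - 1) * α))
                ≤ z₁ * 2 * (2 ^ (ν - 1) * (α ^ (p - 1) * α)) := by
                  gcongr
                  linarith
              _ = 2 * (2 ^ (ν - 1) * (z₁ * α ^ (p - 1))) * α := by ring
              _ ≤ m * α / 2 := by
                rw [hz₁α]
                nlinarith
          have h4 := mul_le_mul_of_nonneg_left hh2 h1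
          nlinarith
        have h5 : z₁ * (2 - z₁) * h z₁ ≤ 0 := mul_nonpos_of_nonneg_of_nonpos h1 hh1
        have h6 : 0 ≤ m * z₁ * g z₁ := by positivity
        have h7 : 0 ≤ m * (1 - z₁) * g z₁ :=
          mul_nonneg (mul_nonneg hm.le (by linarith)) hg10.le
        rw [abs_le]
        constructor <;> linarith
      have hv : emdenVelocity m g h t₁ ^ 2 ≤ m ^ 2 * emdenValue m g t₁ ^ 2 := by
        rw [emdenVelocity, hy1, hzt]
        have := pow_le_pow_left₀ (abs_nonneg _) hX 2
        rw [sq_abs] at this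
        calc _ = sinPow m t₁ ^ 2 * (m * (1 - z₁) * g z₁ + z₁ * (2 - z₁) * h z₁) ^ 2 := by ring
          _ ≤ sinPow m t₁ ^ 2 * (m * g z₁) ^ 2 := by gcongr
          _ = _ := by ring
      have hyp : emdenValue m g t₁ ^ (p + 1) / (p + 1) ≤
          m * a / 4 * emdenValue m g t₁ ^ 2 := by
        have h3 : emdenValue m g t₁ ^ (p + 1) =
            emdenValue m g t₁ ^ (p - 1) * emdenValue m g t₁ ^ 2 := by
          rw [← Real.rpow_natCast, ← Real.rpow_add hypos]
          congr 1
          norm_num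
          ring
        rw [h3, div_le_iff₀ (by linarith)]
        have := mul_le_mul_of_nonneg_right (hyup.trans hκ4) (sq_nonneg (emdenValue m g t₁))
        linarith
      have hlow2 : m * a / 4 * ((κ / 2 ^ (p - 1)) ^ (1 / (p - 1))) ^ 2 ≤
          m * a / 4 * emdenValue m g t₁ ^ 2 := by gcongr
      rw [emdenEnergy]
      linarith }

theorem continuousOn_emden_phase {a b m p s : ℝ} (hp : 0 ≤ p) {g h : ℝ → ℝ → ℝ} {τ : ℝ → ℝ}
    {S : Set ℝ} (hgc : Continuous fun q : ℝ × ℝ => g q.1 q.2)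
    (hhc : Continuous fun q : ℝ × ℝ => h q.1 q.2) (hτ : ContinuousOn τ S)
    (hτ0 : ∀ α ∈ S, τ α ≤ 0) (hlt : ∀ α ∈ S, emdenValue m (g α) (τ α) < s)
    (hr : ∀ α ∈ S, ∀ t ∈ Icc (τ α) 0,
      0 < (emdenValue m (g α) t - s) ^ 2 + emdenVelocity m (g α) (h α) t ^ 2) :
    ContinuousOn (fun α => phase a (τ α) (fun t => 1 - poleCoord t)
      (fun t => emdenValue m (g α) t ^ p - b * emdenValue m (g α) t)
      (fun t => emdenValue m (g α) t - s) (emdenVelocity m (g α) (h α)) 0) S := by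
  have hS := continuous_sinPow m
  have hgz : Continuous fun q : ℝ × ℝ => g q.1 (poleCoord q.2) :=
    hgc.comp (by fun_prop : Continuous fun q : ℝ × ℝ => (q.1, poleCoord q.2))
  have hhz : Continuous fun q : ℝ × ℝ => h q.1 (poleCoord q.2) :=
    hhc.comp (by fun_prop : Continuous fun q : ℝ × ℝ => (q.1, poleCoord q.2))
  have hy : Continuous fun q : ℝ × ℝ => emdenValue m (g q.1) q.2 := by
    unfold emdenValue
    fun_prop
  have hv : Continuous fun q : ℝ × ℝ => emdenVelocity m (g q.1) (h q.1) q.2 := by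
    unfold emdenVelocity
    fun_prop
  have hq : Continuous fun q : ℝ × ℝ => emdenValue m (g q.1) q.2 ^ p :=
    hy.rpow_const fun _ => Or.inr hp
  have hpair : ContinuousOn (fun α => (α, τ α)) S := continuousOn_id.prodMk hτ
  have hy1 : ContinuousOn (fun α => emdenValue m (g α) (τ α)) S := by
    simpa only [Function.comp_def] using hy.comp_continuousOn hpair
  have hv1 : ContinuousOn (fun α => emdenVelocity m (g α) (h α) (τ α)) S := by
    simpa only [Function.comp_def] using hv.comp_continuousOn hpair
  have hstart : ContinuousOn (fun α => Real.arctan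
      (emdenVelocity m (g α) (h α) (τ α) / -(emdenValue m (g α) (τ α) - s))) S :=
    Real.continuous_arctan.comp_continuousOn (hv1.div (by fun_prop) fun α hα => by
      have := hlt α hα
      linarith)
  have hint := continuousOn_integral_moving (f := fun α => angularSpeed a (fun t => 1 - poleCoord t)
      (fun t => emdenValue m (g α) t ^ p - b * emdenValue m (g α) t)
      (fun t => emdenValue m (g α) t - s) (emdenVelocity m (g α) (h α))) hτ hτ0 (by
    unfold angularSpeed
    exact ContinuousOn.div (by fun_prop) (by fun_prop) fun q hq => (hr q.1 hq.1 q.2 hq.2).ne')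
  refine (hstart.add hint).congr fun α _ => ?_
  simp only [phase, Pi.add_apply]

/-- There are solutions on the upper hemisphere, regular at the pole and with vanishing normal
derivative at the equator, whose value at the pole is arbitrarily large. -/
theorem exists_hemisphere_solution {a m p : ℝ} (ha : 0 < a) (hm : 0 < m) (hp : 1 < p)
    (hmp : (p - 1) * m = 2) (hosc : a ^ 2 < 8 * (a + m)) (A : ℝ) :
    ∃ g h h' : ℝ → ℝ, A ≤ g 0 ∧ Continuous h' ∧ (∀ z, HasDerivAt g (h z) z) ∧
      (∀ z ∈ Ioo (-1 : ℝ) (3 / 2), HasDerivAt h (h' z) z) ∧ (∀ z ∈ Icc (0 : ℝ) 1, 0 < g z) ∧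
      (∀ z ∈ Icc (0 : ℝ) 1, z * (2 - z) * h' z + (a + 2 + 2 * m) * (1 - z) * h z =
        m * (a + 1 + m) * g z - g z ^ p) ∧ h 1 = 0 := by
  set ν := (a + 2 + 2 * m) / 2 with hνdef
  have hν : 1 ≤ ν := by rw [hνdef]; linarith
  set μ := m * (a + 1 + m) with hμdef
  have hμ0 : 0 < μ := by positivity
  have hB : 0 < m * (a + m) := by positivity
  set Ck : ℝ := 2 ^ (ν - 1) with hCk
  have hCk0 : 0 < Ck := by positivity
  -- the orbit will be started at `z = κ / α ^ (p - 1)`, with `κ` independent of `α`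
  obtain ⟨κ, hκ0, hκ⟩ : ∃ κ > 0, κ ≤ 1 / 2 ∧ Ck * κ ≤ 1 / 4 ∧ Ck * κ ≤ m / 4 ∧
      2 * κ ≤ m * a * (p + 1) / 4 ∧ 2 * κ < m * (a + m) := by
    have h1 : ∀ᶠ κ in 𝓝[>] (0 : ℝ), κ < 1 / 2 ∧ Ck * κ < 1 / 4 ∧ Ck * κ < m / 4 ∧
        2 * κ < m * a * (p + 1) / 4 ∧ 2 * κ < m * (a + m) := by
      have hlin : ∀ b c : ℝ, 0 < c → ∀ᶠ κ in 𝓝[>] (0 : ℝ), b * κ < c := fun b c hc => by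
        have : Tendsto (fun κ : ℝ => b * κ) (𝓝[>] 0) (𝓝 (b * 0)) :=
          (continuous_const.mul continuous_id).continuousAt.mono_left nhdsWithin_le_nhds
        exact this.eventually (gt_mem_nhds (by simpa using hc))
      filter_upwards [hlin 1 (1 / 2) (by norm_num), hlin Ck (1 / 4) (by norm_num),
        hlin Ck (m / 4) (by positivity), hlin 2 (m * a * (p + 1) / 4) (by positivity),
        hlin 2 _ hB] with κ h1 h2 h3 h4 h5
      exact ⟨by linarith, h2, h3, h4, h5⟩
    obtain ⟨κ, h2, h3⟩ := (h1.and self_mem_nhdsWithin).exists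
    exact ⟨κ, h3, h2.1.le, h2.2.1.le, h2.2.2.1.le, h2.2.2.2.1.le, h2.2.2.2.2⟩
  obtain ⟨hκ1, hκ2, hκ3, hκ4, hκ5⟩ := hκ
  set η := m * a / 4 * ((κ / 2 ^ (p - 1)) ^ (1 / (p - 1))) ^ 2 with hη
  have hη0 : 0 < η := by positivity
  -- the Joseph–Lundgren condition: the linearisation at the equilibrium oscillates
  have hosc' : a ^ 2 / 4 < (p - 1) * (m * (a + m)) := by
    rw [← mul_assoc, hmp]
    linarith
  obtain ⟨σ, hσ, C, K, hbounds⟩ := exists_phase_bounds ha hB hp hη0 hosc'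
  set α₀ := max A (max 1 (2 * μ ^ (1 / (p - 1)))) with hα₀
  have hα₀1 : 1 ≤ α₀ := le_max_of_le_right (le_max_left _ _)
  have hlarge : ∀ α, α₀ ≤ α → 1 ≤ α ∧ μ ≤ (α / 2) ^ (p - 1) := by
    intro α hα
    have h1 : 2 * μ ^ (1 / (p - 1)) ≤ α := (le_max_of_le_right (le_max_right _ _)).trans hα
    refine ⟨hα₀1.trans hα, ?_⟩
    calc μ = (μ ^ (1 / (p - 1))) ^ (p - 1) := by
          rw [← Real.rpow_mul hμ0.le, one_div_mul_cancel (by linarith), Real.rpow_one]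
      _ ≤ (α / 2) ^ (p - 1) :=
          Real.rpow_le_rpow (Real.rpow_nonneg hμ0.le _) (by linarith) (by linarith)
  -- a multiple of `π` above the phase reached from `α₀`, and an `M` whose phase exceeds it
  obtain ⟨k, hk⟩ : ∃ k : ℤ, Real.pi / 2 + K * -startTime p κ α₀ ≤ k * Real.pi := by
    refine ⟨⌈(Real.pi / 2 + K * -startTime p κ α₀) / Real.pi⌉, ?_⟩
    rw [← div_le_iff₀ Real.pi_pos]
    exact Int.le_ceil _
  obtain ⟨M, hM1, hM2, hM3⟩ : ∃ M, α₀ ≤ M ∧ startTime p κ M ≤ -1 ∧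
      k * Real.pi ≤ σ * -startTime p κ M - C := by
    have ht := tendsto_neg_startTime hp hκ0
    have h1 := ht.eventually_ge_atTop 1
    have h2 := ht.eventually_ge_atTop ((k * Real.pi + C) / σ)
    obtain ⟨M, h3, h4, h5⟩ := ((eventually_ge_atTop α₀).and (h1.and h2)).exists
    refine ⟨M, h3, by linarith, ?_⟩
    rw [div_le_iff₀ hσ] at h5
    linarith
  have hM0 : 0 < M := by linarith
  obtain ⟨L, hL⟩ := exists_lipschitzWith_truncatedRHS (μ := μ) hp hM0.le
  set F := truncatedRHS μ p M with hFdef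
  have hF : ContDiff ℝ 1 F := contDiff_truncatedRHS hp
  obtain ⟨g, hgc, hg0, hg⟩ := exists_singular_ivp hν hL
  have hFeq : ∀ α ≤ M, ∀ x ∈ Icc 0 α, F x = μ * x - x ^ p := fun α hα x hx =>
    truncatedRHS_of_mem hp ⟨hx.1, hx.2.trans hα⟩
  have hle : ∀ α ∈ Icc α₀ M, ∀ z ∈ Icc (0 : ℝ) 1, g α z ≤ α := fun α hα z hz => by
    obtain ⟨h1, h2⟩ := hlarge α hα.1
    have hα0 : 0 < α := by linarith
    refine le_initial_of_regular_solution hν hF (hg α) (hg0 α) (fun x hx =>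
      truncatedRHS_neg hp hα0 hα.2 (h2.trans_lt ?_) hx) hz
    exact Real.rpow_lt_rpow (by linarith) (by linarith) (by linarith)
  set h : ℝ → ℝ → ℝ := fun α => regularSlope ν F (g α) with hh
  have horbit := fun α (hα : α ∈ Icc α₀ M) => emdenOrbit_of_regular ha hm hp hmp hκ0 hκ1 hκ2 hκ3
    hκ4 hκ5 (hlarge α hα.1).1 (hlarge α hα.1).2 hF (hFeq α hα.2) (hg α) (hg0 α) (hle α hα)
  have hb := fun α (hα : α ∈ Icc α₀ M) => hbounds _ _ _ _ (horbit α hα).2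
  set s := equilibrium (m * (a + m)) p with hs
  set Φ : ℝ → ℝ := fun α => phase a (startTime p κ α) (fun t => 1 - poleCoord t)
    (fun t => emdenValue m (g α) t ^ p - m * (a + m) * emdenValue m (g α) t)
    (fun t => emdenValue m (g α) t - s) (emdenVelocity m (g α) (h α)) 0 with hΦ
  have hΦc : ContinuousOn Φ (Icc α₀ M) := by
    have hhc : Continuous fun q : ℝ × ℝ => h q.1 q.2 :=
      continuous_regularSlope_param (w := g) hν hF.continuous hgc
    exact continuousOn_emden_phase (by linarith) hgc hhc
      ((continuousOn_startTime hp hκ0 hκ1).mono fun α hα => hα₀1.trans hα.1)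
      (fun α hα => (horbit α hα).2.neg.le) (fun α hα => (horbit α hα).2.start_lt)
      (fun α hα => (hb α hα).2.1)
  obtain ⟨α, hα, hαk⟩ : (k * Real.pi : ℝ) ∈ Φ '' Icc α₀ M :=
    intermediate_value_Icc hM1 hΦc
      ⟨((hb α₀ (left_mem_Icc.mpr hM1)).2.2.1).trans hk,
        hM3.trans ((hb M (right_mem_Icc.mpr hM1)).2.2.2 hM2)⟩
  obtain ⟨hD, hr, -, -⟩ := hb α hα
  have hv0 := hD.velocity_eq_zero hr hαk
  have hpos : ∀ z ∈ Icc (0 : ℝ) 1, 0 < g α z := by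
    intro z hz
    by_cases hz1 : z ≤ κ / α ^ (p - 1)
    · exact (horbit α hα).1 z ⟨hz.1, hz1⟩
    · -- `z` is attained by `poleCoord` on the time interval of the orbit
      have hα1 := (hlarge α hα.1).1
      have hzt := poleCoord_startTime hp hκ0 hκ1 hα1
      obtain ⟨t, ht, rfl⟩ : z ∈ poleCoord '' Icc (startTime p κ α) 0 :=
        intermediate_value_Icc (horbit α hα).2.neg.le continuous_poleCoord.continuousOn
          ⟨by rw [hzt]; exact (not_le.mp hz1).le, by rw [poleCoord_zero]; exact hz.2⟩
      exact pos_of_mul_pos_right ((horbit α hα).2.pos ha.le hp hη0 t ht) (sinPow_pos m t).le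
  refine ⟨g α, h α, regularSlopeDeriv ν F (g α), ?_, ?_, hg α, fun z hz =>
    hasDerivAt_regularSlope hν hF (hg α) hz, hpos, fun z hz => ?_, ?_⟩
  · rw [hg0]
    exact (le_max_left _ _).trans hα.1
  · exact continuous_regularSlopeDeriv hν hF
      (continuous_iff_continuousAt.mpr fun z => (hg α z).continuousAt)
  · rw [← hFeq α hα.2 _ ⟨(hpos z hz).le, hle α hα z hz⟩,
      ← regularSlope_ode hν hF (hg α) ⟨hz.1, by linarith [hz.2]⟩, hνdef]
    ring
  · have h1 := (sinPow_pos m 0).ne'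
    rw [emdenVelocity, poleCoord_zero] at hv0
    rcases mul_eq_zero.mp hv0 with h2 | h2
    · exact absurd h2 h1
    · norm_num at h2
      exact h2

/-! ### Axially symmetric solutions on the sphere -/

theorem hasDerivAt_of_left_right {f f₁ f₂ : ℝ → ℝ} {d : ℝ} (h₁ : ∀ x, 0 ≤ x → f x = f₁ x)
    (h₂ : ∀ x, x ≤ 0 → f x = f₂ x) (hd₁ : HasDerivAt f₁ d 0) (hd₂ : HasDerivAt f₂ d 0) :
    HasDerivAt f d 0 := by
  have h3 : HasDerivWithinAt f d (Ici 0) 0 :=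
    hd₁.hasDerivWithinAt.congr (fun x hx => h₁ x hx) (h₁ 0 le_rfl)
  have h4 : HasDerivWithinAt f d (Iic 0) 0 :=
    hd₂.hasDerivWithinAt.congr (fun x hx => h₂ x hx) (h₂ 0 le_rfl)
  have h5 := h3.union h4
  rwa [union_comm, Iic_union_Ici, hasDerivWithinAt_univ] at h5

/-- The even reflection `x ↦ g (1 - |x|)` across the equator `x = 0` of a solution on the upper
hemisphere, as a function of `x = cos θ`. -/
noncomputable def reflect (g : ℝ → ℝ) (x : ℝ) : ℝ := g (1 - |x|)

/-- The derivative of `reflect g`, where `h` is the derivative of `g`. -/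
noncomputable def reflectDeriv (h : ℝ → ℝ) (x : ℝ) : ℝ := if 0 ≤ x then -h (1 - x) else h (1 + x)

theorem hasDerivAt_reflect {g h : ℝ → ℝ} (hg : ∀ z, HasDerivAt g (h z) z) (h1 : h 1 = 0) (x : ℝ) :
    HasDerivAt (reflect g) (reflectDeriv h x) x := by
  have hr : ∀ x, HasDerivAt (fun x => g (1 - x)) (-h (1 - x)) x := fun x =>
    ((hg (1 - x)).comp x ((hasDerivAt_id x).const_sub 1)).congr_deriv (by simp)
  have hl : ∀ x, HasDerivAt (fun x => g (1 + x)) (h (1 + x)) x := fun x =>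
    ((hg (1 + x)).comp x ((hasDerivAt_id x).const_add 1)).congr_deriv (by simp)
  have er : ∀ x, 0 ≤ x → reflect g x = g (1 - x) := fun x hx => by rw [reflect, abs_of_nonneg hx]
  have el : ∀ x, x ≤ 0 → reflect g x = g (1 + x) := fun x hx => by
    rw [reflect, abs_of_nonpos hx, sub_neg_eq_add]
  rcases lt_trichotomy x 0 with hx | rfl | hx
  · rw [reflectDeriv, if_neg (not_le.mpr hx)]
    refine (hl x).congr_of_eventuallyEq ?_
    filter_upwards [gt_mem_nhds hx] with y hy using el y hy.le
  · rw [reflectDeriv, if_pos le_rfl, sub_zero, h1, neg_zero]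
    exact hasDerivAt_of_left_right er el (by simpa [h1] using hr 0) (by simpa [h1] using hl 0)
  · rw [reflectDeriv, if_pos hx.le]
    refine (hr x).congr_of_eventuallyEq ?_
    filter_upwards [lt_mem_nhds hx] with y hy using er y hy.le

theorem hasDerivAt_reflectDeriv {h h' : ℝ → ℝ}
    (hh : ∀ z ∈ Ioo (-1 : ℝ) (3 / 2), HasDerivAt h (h' z) z) (h1 : h 1 = 0) {x : ℝ}
    (hx2 : |x| < 2) : HasDerivAt (reflectDeriv h) (reflect h' x) x := by
  obtain ⟨hxl, hxr⟩ := abs_lt.mp hx2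
  have hr : ∀ x, 0 ≤ x → x < 2 → HasDerivAt (fun x => -h (1 - x)) (h' (1 - x)) x := fun x h0 h2 =>
    ((hh (1 - x) ⟨by linarith, by linarith⟩).comp x
      ((hasDerivAt_id x).const_sub 1)).neg.congr_deriv (by simp)
  have hl : ∀ x, x ≤ 0 → -2 < x → HasDerivAt (fun x => h (1 + x)) (h' (1 + x)) x := fun x h0 h2 =>
    ((hh (1 + x) ⟨by linarith, by linarith⟩).comp x
      ((hasDerivAt_id x).const_add 1)).congr_deriv (by simp)
  have er : ∀ x, 0 ≤ x → reflectDeriv h x = -h (1 - x) := fun x hx => by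
    rw [reflectDeriv, if_pos hx]
  have el : ∀ x, x ≤ 0 → reflectDeriv h x = h (1 + x) := fun x hx => by
    rcases hx.eq_or_lt with rfl | hx
    · simp [reflectDeriv, h1]
    · rw [reflectDeriv, if_neg (not_le.mpr hx)]
  rcases lt_trichotomy x 0 with hx | rfl | hx
  · rw [reflect, abs_of_neg hx, sub_neg_eq_add]
    refine (hl x hx.le hxl).congr_of_eventuallyEq ?_
    filter_upwards [gt_mem_nhds hx] with y hy using el y hy.le
  · rw [reflect, abs_zero, sub_zero]
    exact hasDerivAt_of_left_right er el (by simpa using hr 0 le_rfl (by norm_num))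
      (by simpa using hl 0 le_rfl (by norm_num))
  · rw [reflect, abs_of_pos hx]
    refine (hr x hx.le hxr).congr_of_eventuallyEq ?_
    filter_upwards [lt_mem_nhds hx] with y hy using er y hy.le

/-- The data of an even profile `H` on `[-1, 1]` (with derivatives `H₁`, `H₂`), twice continuously
differentiable on `(-2, 2)`, such that `σ ↦ H ⟨e, σ⟩` solves the equation on the sphere. -/
structure SphereProfile (N : ℕ) (p : ℝ) (H H₁ H₂ : ℝ → ℝ) : Prop where
  deriv₁ : ∀ x, HasDerivAt H (H₁ x) x
  deriv₂ : ∀ x ∈ Ioo (-2 : ℝ) 2, HasDerivAt H₁ (H₂ x) x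
  cont : Continuous H₂
  pos : ∀ x ∈ Icc (-1 : ℝ) 1, 0 < H x
  equation : ∀ x ∈ Icc (-1 : ℝ) 1,
    (1 - x ^ 2) * H₂ x - ((N : ℝ) - 1) * x * H₁ x = mu N p * H x - H x ^ p

theorem iteratedDeriv_two_eq {f f₁ : ℝ → ℝ} {d : ℝ} (h₁ : ∀ᶠ t in 𝓝 0, HasDerivAt f (f₁ t) t)
    (h₂ : HasDerivAt f₁ d 0) : iteratedDeriv 2 f 0 = d := by
  have h3 : deriv f =ᶠ[𝓝 0] f₁ := h₁.mono fun t ht => ht.deriv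
  rw [iteratedDeriv_succ, iteratedDeriv_one, h3.deriv_eq, h₂.deriv]

theorem abs_inner_le_one {N : ℕ} (e σ : Sphere N) :
    inner ℝ (e : Space N) (σ : Space N) ∈ Icc (-1 : ℝ) 1 := by
  have h := abs_real_inner_le_norm (e : Space N) (σ : Space N)
  rw [mem_sphere_zero_iff_norm.mp e.2, mem_sphere_zero_iff_norm.mp σ.2, one_mul] at h
  exact abs_le.mp h

theorem finrank_tangent {N : ℕ} (σ : Sphere N) :
    (Module.finrank ℝ (Tangent σ) : ℝ) = (N : ℝ) - 1 := by
  have hσ0 : (σ : Space N) ≠ 0 := by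
    rw [← norm_ne_zero_iff, mem_sphere_zero_iff_norm.mp σ.2]
    exact one_ne_zero
  have h := (ℝ ∙ (σ : Space N)).finrank_add_finrank_orthogonal
  rw [finrank_span_singleton hσ0, finrank_euclideanSpace_fin] at h
  have h' : ((1 + Module.finrank ℝ (Tangent σ) : ℕ) : ℝ) = N := congrArg _ h
  push_cast at h'
  linarith

/-- Parseval in the tangent space, applied to the tangential part of the pole. -/
theorem sum_sq_inner_tangent {N : ℕ} (e σ : Sphere N) :
    ∑ i, inner ℝ (e : Space N) (stdOrthonormalBasis ℝ (Tangent σ) i : Space N) ^ 2 =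
      1 - inner ℝ (e : Space N) (σ : Space N) ^ 2 := by
  set b := stdOrthonormalBasis ℝ (Tangent σ)
  set x := inner ℝ (e : Space N) (σ : Space N) with hx
  have hσ : ‖(σ : Space N)‖ = 1 := mem_sphere_zero_iff_norm.mp σ.2
  have he : ‖(e : Space N)‖ = 1 := mem_sphere_zero_iff_norm.mp e.2
  have hmem : (e : Space N) - x • (σ : Space N) ∈ Tangent σ := by
    rw [Submodule.mem_orthogonal_singleton_iff_inner_right, inner_sub_right, inner_smul_right,
      real_inner_self_eq_norm_sq, hσ, real_inner_comm]
    simp [hx]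
  set w : Tangent σ := ⟨(e : Space N) - x • (σ : Space N), hmem⟩ with hw
  have h1 : ∀ i, inner ℝ (e : Space N) (b i : Space N) = inner ℝ w (b i) := by
    intro i
    rw [Submodule.coe_inner, hw, inner_sub_left, inner_smul_left, inner_tangent]
    simp
  have h2 := b.sum_sq_norm_inner_left w
  simp only [Real.norm_eq_abs, sq_abs] at h2
  simp only [h1]
  rw [h2, ← Submodule.norm_coe, hw, norm_sub_sq_real, inner_smul_right, norm_smul, he, hσ, ← hx,
    Real.norm_eq_abs]
  rw [mul_one, sq_abs]
  ring

namespace SphereProfile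

variable {N : ℕ} {p : ℝ} {H H₁ H₂ : ℝ → ℝ}

theorem contDiffOn (h : SphereProfile N p H H₁ H₂) : ContDiffOn ℝ 2 H (Ioo (-2) 2) := by
  have e1 : deriv H = H₁ := funext fun x => (h.deriv₁ x).deriv
  rw [show (2 : WithTop ℕ∞) = 1 + 1 by norm_num, contDiffOn_succ_iff_deriv_of_isOpen isOpen_Ioo, e1]
  refine ⟨fun x _ => (h.deriv₁ x).differentiableAt.differentiableWithinAt, by simp, ?_⟩
  rw [show (1 : WithTop ℕ∞) = 0 + 1 by norm_num, contDiffOn_succ_iff_deriv_of_isOpen isOpen_Ioo]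
  refine ⟨fun x hx => (h.deriv₂ x hx).differentiableAt.differentiableWithinAt, by simp, ?_⟩
  rw [contDiffOn_zero]
  exact h.cont.continuousOn.congr fun x hx => (h.deriv₂ x hx).deriv

theorem contDiffAt (h : SphereProfile N p H H₁ H₂) {x : ℝ} (hx : x ∈ Icc (-1 : ℝ) 1) :
    ContDiffAt ℝ 2 H x :=
  h.contDiffOn.contDiffAt (Ioo_mem_nhds (by linarith [hx.1]) (by linarith [hx.2]))

theorem isPositiveSphereSolution [NeZero N] (h : SphereProfile N p H H₁ H₂) (e : Sphere N) :
    IsPositiveSphereSolution N p fun σ => H (inner ℝ (e : Space N) (σ : Space N)) where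
  contMDiff := by
    intro σ
    have h1 : ContMDiff (𝓡 (N - 1)) 𝓘(ℝ, Space N) 2 ((↑) : Sphere N → Space N) :=
      contMDiff_coe_sphere
    have h2 : ContDiffAt ℝ 2 (fun y : Space N => H (inner ℝ (e : Space N) y)) σ :=
      ContDiffAt.comp (σ : Space N) (h.contDiffAt (abs_inner_le_one e σ))
        (contDiff_const.inner ℝ contDiff_id).contDiffAt
    exact h2.comp_contMDiffAt (h1 σ)
  pos σ := h.pos _ (abs_inner_le_one e σ)
  equation σ := by
    set x := inner ℝ (e : Space N) (σ : Space N) with hx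
    have hxm : x ∈ Icc (-1 : ℝ) 1 := abs_inner_le_one e σ
    set b := stdOrthonormalBasis ℝ (Tangent σ) with hb
    have h1 : ∀ i, iteratedDeriv 2 (fun t : ℝ =>
        H (inner ℝ (e : Space N) (greatCircle σ (b i) (b.orthonormal.1 i) t : Space N))) 0 =
        H₂ x * inner ℝ (e : Space N) (b i : Space N) ^ 2 - x * H₁ x := by
      intro i
      set y := inner ℝ (e : Space N) (b i : Space N) with hy
      have hc : ∀ t, HasDerivAt (fun t : ℝ => Real.cos t * x + Real.sin t * y)
          (-Real.sin t * x + Real.cos t * y) t := fun t =>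
        ((Real.hasDerivAt_cos t).mul_const x).add ((Real.hasDerivAt_sin t).mul_const y)
      have hc' : HasDerivAt (fun t : ℝ => -Real.sin t * x + Real.cos t * y)
          (-Real.cos 0 * x + -Real.sin 0 * y) 0 :=
        ((Real.hasDerivAt_sin 0).neg.mul_const x).add ((Real.hasDerivAt_cos 0).mul_const y)
      have he : (fun t : ℝ =>
          H (inner ℝ (e : Space N) (greatCircle σ (b i) (b.orthonormal.1 i) t : Space N))) =
          fun t => H (Real.cos t * x + Real.sin t * y) := by
        funext t
        simp only [greatCircle, inner_add_right, inner_smul_right, hx, hy]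
      have h2 : HasDerivAt H₁ (H₂ x) (Real.cos 0 * x + Real.sin 0 * y) := by
        simpa using h.deriv₂ x ⟨by linarith [hxm.1], by linarith [hxm.2]⟩
      rw [he, iteratedDeriv_two_eq (f := fun t => H (Real.cos t * x + Real.sin t * y))
        (Eventually.of_forall fun t => (h.deriv₁ _).comp t (hc t))
        ((h2.comp (0 : ℝ) (hc 0)).mul hc')]
      simp
      ring
    rw [sphereLaplacian, Finset.sum_congr rfl fun i _ => h1 i, Finset.sum_sub_distrib,
      ← Finset.mul_sum, sum_sq_inner_tangent, Finset.sum_const, Finset.card_univ, Fintype.card_fin,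
      nsmul_eq_mul, finrank_tangent, ← hx]
    linarith [h.equation x hxm]

theorem isAxiallySymmetric (e : Sphere N) (H : ℝ → ℝ) :
    IsAxiallySymmetric e fun σ => H (inner ℝ (e : Space N) (σ : Space N)) := by
  refine ⟨fun θ => H (Real.cos θ), fun σ => ?_⟩
  beta_reduce
  rw [InnerProductGeometry.cos_angle, mem_sphere_zero_iff_norm.mp e.2,
    mem_sphere_zero_iff_norm.mp σ.2]
  simp

end SphereProfile

/-! ### Separated solutions of the Lane–Emden equation -/

/-- The second derivative at `0` of `ρ ^ (-m) H ((q + t b) / ρ)` along a line `x + t v`, where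
`ρ = ‖x + t v‖`, `y = ⟨x, v⟩`, `q = ⟨e, x⟩` and `b = ⟨e, v⟩`. -/
theorem iteratedDeriv_two_line {H H₁ : ℝ → ℝ} {m q b y r d : ℝ} {ρ : ℝ → ℝ} (hr : 0 < r)
    (hρ0 : ρ 0 = r) (hρ : ∀ᶠ t in 𝓝 0, 0 < ρ t ∧ HasDerivAt ρ ((y + t) / ρ t) t)
    (hH : ∀ x, HasDerivAt H (H₁ x) x) (hH₁ : HasDerivAt H₁ d (q / r)) :
    iteratedDeriv 2 (fun t => ρ t ^ (-m) * H ((q + t * b) / ρ t)) 0 =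
      r ^ (-m) * ((-m / r ^ 2 * H (q / r) - q / r ^ 3 * H₁ (q / r)) +
        ((m ^ 2 + 2 * m) / r ^ 4 * H (q / r) + (2 * m + 3) * q / r ^ 5 * H₁ (q / r) +
          q ^ 2 / r ^ 6 * d) * y ^ 2 + d / r ^ 2 * b ^ 2 +
        (-(2 * m + 2) / r ^ 3 * H₁ (q / r) - 2 * q / r ^ 4 * d) * (b * y)) := by
  have hA : ∀ t, 0 < ρ t → HasDerivAt ρ ((y + t) / ρ t) t →
      HasDerivAt (fun t => ρ t ^ (-m)) (ρ t ^ (-m) * (-m * ((y + t) / ρ t ^ 2))) t := by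
    intro t h0 h1
    refine (h1.rpow_const (p := -m) (Or.inl h0.ne')).congr_deriv ?_
    rw [Real.rpow_sub_one h0.ne']
    field_simp
  have hlin : ∀ t, HasDerivAt (fun t : ℝ => q + t * b) b t := fun t =>
    (((hasDerivAt_id t).mul_const b).const_add q).congr_deriv (by simp)
  have hlin' : ∀ t, HasDerivAt (fun t : ℝ => y + t) 1 t := fun t => (hasDerivAt_id t).const_add y
  have hS : ∀ t, 0 < ρ t → HasDerivAt ρ ((y + t) / ρ t) t →
      HasDerivAt (fun t => (q + t * b) / ρ t)
        (b / ρ t - (q + t * b) * (y + t) / ρ t ^ 3) t := by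
    intro t h0 h1
    refine ((hlin t).div h1 h0.ne').congr_deriv ?_
    field_simp
  refine iteratedDeriv_two_eq (f₁ := fun t => ρ t ^ (-m) * (-m * ((y + t) / ρ t ^ 2)) *
    H ((q + t * b) / ρ t) + ρ t ^ (-m) * (H₁ ((q + t * b) / ρ t) *
      (b / ρ t - (q + t * b) * (y + t) / ρ t ^ 3))) ?_ ?_
  · filter_upwards [hρ] with t ht
    exact (hA t ht.1 ht.2).mul ((hH _).comp t (hS t ht.1 ht.2))
  · obtain ⟨h0, h1⟩ := hρ.self_of_nhds
    have hS0 := hS 0 h0 h1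
    have hA0 := hA 0 h0 h1
    have hH₁' : HasDerivAt H₁ d ((q + 0 * b) / ρ 0) := by
      rw [hρ0]
      simpa using hH₁
    have hP := (((hlin' 0).div (h1.pow 2) (pow_ne_zero 2 h0.ne')).const_mul (-m))
    have hQ := ((hasDerivAt_const (0 : ℝ) b).div h1 h0.ne').sub
      (((hlin 0).mul (hlin' 0)).div (h1.pow 3) (pow_ne_zero 3 h0.ne'))
    have h2 := ((hA0.mul hP).mul ((hH _).comp (0 : ℝ) hS0)).add
      (hA0.mul ((hH₁'.comp (0 : ℝ) hS0).mul hQ))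
    refine h2.congr_deriv ?_
    simp only [Pi.mul_apply, Pi.pow_apply, Pi.div_apply, Pi.sub_apply, Function.comp_apply, hρ0,
      zero_mul, add_zero]
    field_simp
    norm_num
    ring

/-- The function `|x| ^ (-m) H (⟨e, x⟩ / |x|)`. -/
noncomputable def separatedField {N : ℕ} (m : ℝ) (H : ℝ → ℝ) (e : Sphere N) (x : Space N) : ℝ :=
  ‖x‖ ^ (-m) * H (inner ℝ (e : Space N) x / ‖x‖)

theorem inner_div_norm_mem {N : ℕ} (e : Sphere N) (x : Space N) :
    inner ℝ (e : Space N) x / ‖x‖ ∈ Icc (-1 : ℝ) 1 := by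
  have h := abs_real_inner_div_norm_mul_norm_le_one (e : Space N) x
  rw [mem_sphere_zero_iff_norm.mp e.2, one_mul] at h
  exact abs_le.mp h

namespace SphereProfile

variable {N : ℕ} {p m : ℝ} {H H₁ H₂ : ℝ → ℝ}

theorem contDiffAt_separatedField (h : SphereProfile N p H H₁ H₂) (m : ℝ) (e : Sphere N)
    {x : Space N} (hx : x ≠ 0) : ContDiffAt ℝ 2 (separatedField m H e) x := by
  have h0 : ‖x‖ ≠ 0 := norm_ne_zero_iff.mpr hx
  have h1 : ContDiffAt ℝ 2 (fun x : Space N => ‖x‖) x := contDiffAt_norm ℝ hx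
  have h2 : ContDiffAt ℝ 2 (fun x : Space N => inner ℝ (e : Space N) x / ‖x‖) x :=
    (contDiff_const.inner ℝ contDiff_id).contDiffAt.div h1 h0
  exact (h1.rpow_const_of_ne h0).mul
    (ContDiffAt.comp x (h.contDiffAt (inner_div_norm_mem e x)) h2)

theorem laplacian_separatedField (h : SphereProfile N p H H₁ H₂) (m : ℝ) (e : Sphere N)
    {x : Space N} (hx : x ≠ 0) :
    Laplacian.laplacian (separatedField m H e) x = ‖x‖ ^ (-m) / ‖x‖ ^ 2 *
      ((1 - (inner ℝ (e : Space N) x / ‖x‖) ^ 2) * H₂ (inner ℝ (e : Space N) x / ‖x‖) -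
        ((N : ℝ) - 1) * (inner ℝ (e : Space N) x / ‖x‖) * H₁ (inner ℝ (e : Space N) x / ‖x‖) -
        m * (N - 2 - m) * H (inner ℝ (e : Space N) x / ‖x‖)) := by
  set U := separatedField m H e with hU
  set B := EuclideanSpace.basisFun (Fin N) ℝ with hB
  set q := inner ℝ (e : Space N) x with hq
  set r := ‖x‖ with hr
  have hr0 : 0 < r := norm_pos_iff.mpr hx
  have hmem := inner_div_norm_mem e x
  have hline : ∀ i, iteratedFDeriv ℝ 2 U x ![B i, B i] =
      r ^ (-m) * ((-m / r ^ 2 * H (q / r) - q / r ^ 3 * H₁ (q / r)) +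
        ((m ^ 2 + 2 * m) / r ^ 4 * H (q / r) + (2 * m + 3) * q / r ^ 5 * H₁ (q / r) +
          q ^ 2 / r ^ 6 * H₂ (q / r)) * inner ℝ x (B i) ^ 2 +
        H₂ (q / r) / r ^ 2 * inner ℝ (e : Space N) (B i) ^ 2 +
        (-(2 * m + 2) / r ^ 3 * H₁ (q / r) - 2 * q / r ^ 4 * H₂ (q / r)) *
          (inner ℝ (e : Space N) (B i) * inner ℝ x (B i))) := by
    intro i
    set y := inner ℝ x (B i) with hy
    have hBi : ‖B i‖ = 1 := B.orthonormal.1 i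
    have hnorm : ∀ t : ℝ, ‖x + t • B i‖ = √(r ^ 2 + 2 * (t * y) + t ^ 2) := by
      intro t
      rw [← Real.sqrt_sq (norm_nonneg (x + t • B i)), norm_add_sq_real, inner_smul_right, norm_smul,
        hBi, mul_one, Real.norm_eq_abs, sq_abs]
    have hcurve := iteratedDeriv_two_comp_curve (F := U) (c := fun t : ℝ => x + t • B i)
      (c' := fun _ => B i) (a := 0)
      (by simpa using h.contDiffAt_separatedField m e hx)
      (fun t => by simpa using ((hasDerivAt_id t).smul_const (B i)).const_add x)
      (hasDerivAt_const _ _)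
    simp only [zero_smul, add_zero, map_zero] at hcurve
    rw [iteratedFDeriv_two_apply]
    simp only [Matrix.cons_val_zero, Matrix.cons_val_one]
    rw [← hcurve]
    have hUt : (fun t : ℝ => U (x + t • B i)) = fun t =>
        ‖x + t • B i‖ ^ (-m) * H ((q + t * inner ℝ (e : Space N) (B i)) / ‖x + t • B i‖) := by
      funext t
      rw [hU, separatedField, inner_add_right, inner_smul_right]
    rw [hUt]
    refine iteratedDeriv_two_line hr0 (by simp [hr]) ?_ h.deriv₁
      (h.deriv₂ _ ⟨by linarith [hmem.1], by linarith [hmem.2]⟩)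
    have hpos : ∀ᶠ t : ℝ in 𝓝 0, 0 < r ^ 2 + 2 * (t * y) + t ^ 2 := by
      have hc : ContinuousAt (fun t : ℝ => r ^ 2 + 2 * (t * y) + t ^ 2) 0 := by fun_prop
      refine hc.eventually (lt_mem_nhds ?_)
      simpa using pow_pos hr0 2
    filter_upwards [hpos] with t ht
    rw [funext hnorm]
    refine ⟨by rw [hnorm]; exact Real.sqrt_pos.mpr ht, ?_⟩
    have h1 : HasDerivAt (fun t : ℝ => r ^ 2 + 2 * (t * y) + t ^ 2) (2 * y + 2 * t) t :=
      (((((hasDerivAt_id t).mul_const y).const_mul 2).const_add (r ^ 2)).add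
        ((hasDerivAt_id t).pow 2)).congr_deriv (by simp)
    refine (h1.sqrt ht.ne').congr_deriv ?_
    rw [hnorm]
    have := (Real.sqrt_pos.mpr ht).ne'
    field_simp
  have hsum1 : ∑ i, inner ℝ x (B i) ^ 2 = r ^ 2 := by
    have := B.sum_sq_norm_inner_left x
    simpa only [Real.norm_eq_abs, sq_abs] using this
  have hsum2 : ∑ i, inner ℝ (e : Space N) (B i) ^ 2 = 1 := by
    have := B.sum_sq_norm_inner_left (e : Space N)
    rw [mem_sphere_zero_iff_norm.mp e.2] at this
    simpa only [Real.norm_eq_abs, sq_abs, one_pow] using this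
  have hsum3 : ∑ i, inner ℝ (e : Space N) (B i) * inner ℝ x (B i) = q := by
    have := B.sum_inner_mul_inner (e : Space N) x
    rw [hq, ← this]
    exact Finset.sum_congr rfl fun i _ => by rw [real_inner_comm x (B i)]
  rw [laplacian_eq_iteratedFDeriv_orthonormalBasis U B]
  simp only [hline]
  rw [← Finset.mul_sum, Finset.sum_add_distrib, Finset.sum_add_distrib, Finset.sum_add_distrib,
    ← Finset.mul_sum, ← Finset.mul_sum, ← Finset.mul_sum, hsum1, hsum2, hsum3, Finset.sum_const,
    Finset.card_univ, Fintype.card_fin, nsmul_eq_mul]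
  field_simp
  ring

theorem isPositiveLaneEmdenSolution (h : SphereProfile N p H H₁ H₂) (hp : 1 < p) (e : Sphere N) :
    IsPositiveLaneEmdenSolution N p (separatedField (2 / (p - 1)) H e) where
  contDiffOn x hx := (h.contDiffAt_separatedField _ e hx).contDiffWithinAt
  pos x hx := mul_pos (Real.rpow_pos_of_pos (norm_pos_iff.mpr hx) _)
    (h.pos _ (inner_div_norm_mem e x))
  equation x hx := by
    have hr0 : 0 < ‖x‖ := norm_pos_iff.mpr hx
    have hmem := inner_div_norm_mem e x
    have h1 := h.equation _ hmem
    rw [h.laplacian_separatedField _ e hx, separatedField,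
      Real.mul_rpow (Real.rpow_nonneg hr0.le _) (h.pos _ hmem).le, ← Real.rpow_mul hr0.le]
    have h2 : ‖x‖ ^ (-(2 / (p - 1)) * p) = ‖x‖ ^ (-(2 / (p - 1))) / ‖x‖ ^ 2 := by
      rw [← Real.rpow_natCast, ← Real.rpow_sub hr0]
      congr 1
      have : p - 1 ≠ 0 := by linarith
      field_simp
      norm_num
      ring
    rw [h2]
    rw [mu] at h1
    linear_combination (‖x‖ ^ (-(2 / (p - 1))) / ‖x‖ ^ 2) * h1

theorem isSingular (h : SphereProfile N p H H₁ H₂) (hm : 0 < m) (e : Sphere N) :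
    IsSingular (separatedField m H e) := by
  have hHc : Continuous H := continuous_iff_continuousAt.mpr fun x => (h.deriv₁ x).continuousAt
  obtain ⟨x₀, hx₀, hmin⟩ := isCompact_Icc.exists_isMinOn
    (nonempty_Icc.mpr (by norm_num : (-1 : ℝ) ≤ 1)) hHc.continuousOn
  have h1 : Tendsto (fun x : Space N => ‖x‖ ^ (-m)) (𝓝[≠] 0) atTop :=
    (tendsto_rpow_neg_nhdsGT_zero (neg_lt_zero.mpr hm)).comp tendsto_norm_nhdsNE_zero
  refine tendsto_atTop_mono (fun x => ?_) (h1.atTop_mul_const (h.pos x₀ hx₀))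
  exact mul_le_mul_of_nonneg_left (hmin (inner_div_norm_mem e x)) (by positivity)

theorem isSeparated (p : ℝ) (H : ℝ → ℝ) (e : Sphere N) :
    IsSeparated p (fun σ => H (inner ℝ (e : Space N) (σ : Space N)))
      (separatedField (2 / (p - 1)) H e) := by
  intro x hx
  simp only [separatedField, direction, inner_smul_right]
  rw [inv_mul_eq_div]

theorem separatedField_sphere (m : ℝ) (H : ℝ → ℝ) (e σ : Sphere N) :
    separatedField m H e σ = H (inner ℝ (e : Space N) (σ : Space N)) := by
  simp [separatedField]

end SphereProfile

/-- A positive solution on the sphere that is constant has the value `μ ^ (1 / (p - 1))`. -/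
theorem IsPositiveSphereSolution.rpow_eq_mu_of_const {N : ℕ} [NeZero N] {p c : ℝ}
    (hp : 1 < p) (σ : Sphere N) (h : IsPositiveSphereSolution N p fun _ => c) :
    c ^ (p - 1) = mu N p := by
  have h1 := h.equation σ
  have h2 := h.pos σ
  simp only [sphereLaplacian, iteratedDeriv_const] at h1
  simp at h1
  rw [rpow_eq_rpow_sub_one_mul hp h2.le] at h1
  refine mul_right_cancel₀ h2.ne' ?_
  linarith

/-- The parameter range, in terms of `m = 2 / (p - 1)` and `a = N - 3 - 2 m`: the exponent is
supercritical on `𝕊^{N-1}`, and the linearisation at the equilibrium is oscillatory. -/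
theorem exponent_range {N : ℕ} (hN : 4 ≤ N) {p : ℝ} (hp : ((N : ℝ) + 1) / ((N : ℝ) - 3) < p)
    (hpJL : (p : EReal) < pJL (N - 1)) :
    1 < p ∧ 0 < (N : ℝ) - 3 - 2 * (2 / (p - 1)) ∧
      ((N : ℝ) - 3 - 2 * (2 / (p - 1))) ^ 2 < 8 * ((N : ℝ) - 3 - 2 / (p - 1)) := by
  have hN' : (4 : ℝ) ≤ N := by exact_mod_cast hN
  have h3 : 0 < (N : ℝ) - 3 := by linarith
  rw [div_lt_iff₀ h3] at hp
  have hp1 : 1 < p := by nlinarith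
  have hq : 0 < p - 1 := by linarith
  set m := 2 / (p - 1) with hm
  have hm0 : 0 < m := by positivity
  have hmul : m * (p - 1) = 2 := div_mul_cancel₀ _ hq.ne'
  have ha : 0 < (N : ℝ) - 3 - 2 * m := by
    by_contra! h
    nlinarith
  set s := √((N : ℝ) - 2) with hs
  have hs2 : s ^ 2 = (N : ℝ) - 2 := Real.sq_sqrt (by linarith)
  have hs0 : 0 ≤ s := Real.sqrt_nonneg _
  have hs1 : 1 ≤ s := by
    rw [hs]
    exact Real.one_le_sqrt.mpr (by linarith)
  have hlow : (N : ℝ) - 5 - 2 * s < 2 * m := by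
    rw [pJL] at hpJL
    split_ifs at hpJL with h11
    · rw [EReal.coe_lt_coe_iff, Nat.cast_sub (by omega)] at hpJL
      have e1 : (N : ℝ) - (1 : ℕ) - 4 - 2 * √((N : ℝ) - (1 : ℕ) - 1) = N - 5 - 2 * s := by
        rw [hs]
        push_cast
        rw [show (N : ℝ) - 1 - 1 = N - 2 by ring]
        ring
      rw [e1] at hpJL
      by_contra! hle
      have hD : 0 < (N : ℝ) - 5 - 2 * s := by linarith
      have h4 : p - 1 < 4 / ((N : ℝ) - 5 - 2 * s) := by linarith
      rw [lt_div_iff₀ hD] at h4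
      nlinarith
    · have hN11 : (N : ℝ) ≤ 11 := by exact_mod_cast (by omega : N ≤ 11)
      have : (N : ℝ) - 5 ≤ 2 * s := by
        refine abs_le_of_sq_le_sq' ?_ (by linarith) |>.2
        nlinarith
      linarith
  refine ⟨hp1, ha, ?_⟩
  -- the claim is equivalent to `(2 m - (N - 5))² < 4 (N - 2)`
  have hsq : (2 * m - ((N : ℝ) - 5)) ^ 2 < (2 * s) ^ 2 :=
    sq_lt_sq' (by linarith) (by linarith)
  nlinarith

/-- Axially symmetric profiles with arbitrarily large values at the pole. -/
theorem exists_sphereProfile {N : ℕ} {p : ℝ} (hp : 1 < p)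
    (ha : 0 < (N : ℝ) - 3 - 2 * (2 / (p - 1)))
    (hosc : ((N : ℝ) - 3 - 2 * (2 / (p - 1))) ^ 2 < 8 * ((N : ℝ) - 3 - 2 / (p - 1))) (A : ℝ) :
    ∃ H H₁ H₂ : ℝ → ℝ, SphereProfile N p H H₁ H₂ ∧ A ≤ H 1 := by
  set m := 2 / (p - 1) with hm
  have hq : 0 < p - 1 := by linarith
  have hm0 : 0 < m := by positivity
  obtain ⟨g, h, h', hA, hc, hg, hh, hpos, hode, h1⟩ := exists_hemisphere_solution ha hm0 hp
    (mul_div_cancel₀ _ hq.ne') (by linarith) A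
  refine ⟨reflect g, reflectDeriv h, reflect h', ⟨hasDerivAt_reflect hg h1, fun x hx =>
    hasDerivAt_reflectDeriv hh h1 (abs_lt.mpr hx), ?_, fun x hx => ?_, fun x hx => ?_⟩, ?_⟩
  · unfold reflect
    fun_prop
  · have := abs_le.mpr hx
    exact hpos _ ⟨by linarith, by linarith [abs_nonneg x]⟩
  · have hx1 := abs_le.mpr hx
    have h2 := hode (1 - |x|) ⟨by linarith, by linarith [abs_nonneg x]⟩
    have h3 : x * reflectDeriv h x = -(|x| * h (1 - |x|)) := by
      rw [reflectDeriv]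
      split_ifs with hx0
      · rw [abs_of_nonneg hx0]
        ring
      · rw [abs_of_neg (not_le.mp hx0), sub_neg_eq_add]
        ring
    rw [mu, ← hm]
    simp only [reflect]
    have h4 : |x| ^ 2 = x ^ 2 := sq_abs x
    linear_combination h2 - (N - 1) * h3 + h' (1 - |x|) * h4
  · simpa [reflect] using hA

theorem infinite_of_unbounded_eval {ι : Type*} {S : Set (ι → ℝ)} (i : ι)
    (h : ∀ A : ℝ, ∃ V ∈ S, A ≤ V i) : S.Infinite := by
  refine Set.Infinite.of_image (fun V => V i) (Set.infinite_of_not_bddAbove fun ⟨b, hb⟩ => ?_)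
  obtain ⟨V, hV, hA⟩ := h (b + 1)
  have := hb ⟨V, hV, rfl⟩
  linarith

end SingularLaneEmden

/-- Functions on `ℝ^N ∖ {0}` are counted through their restrictions to that set, so that values
at the origin play no role. The pole `e` is fixed before the solutions are counted. -/
theorem mainTheorem3 (N : ℕ) [NeZero N] (hN : 4 ≤ N) (p : ℝ)
    (hp : ((N : ℝ) + 1) / ((N : ℝ) - 3) < p)
    (hpJL : (p : EReal) < SingularLaneEmden.pJL (N - 1))
    (e : SingularLaneEmden.Sphere N) :
    {V : SingularLaneEmden.Sphere N → ℝ |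
        SingularLaneEmden.IsPositiveSphereSolution N p V ∧
        SingularLaneEmden.IsAxiallySymmetric e V}.Infinite ∧
    (({0}ᶜ : Set (SingularLaneEmden.Space N)).domRestrict ''
      {U : SingularLaneEmden.Space N → ℝ |
        SingularLaneEmden.IsPositiveLaneEmdenSolution N p U ∧
        SingularLaneEmden.IsSingular U ∧
        ¬ SingularLaneEmden.IsRadial U ∧
        ∃ V : SingularLaneEmden.Sphere N → ℝ,
          SingularLaneEmden.IsPositiveSphereSolution N p V ∧
          SingularLaneEmden.IsAxiallySymmetric e V ∧
          SingularLaneEmden.IsSeparated p V U}).Infinite := by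
  obtain ⟨hp1, ha, hosc⟩ := SingularLaneEmden.exponent_range hN hp hpJL
  have he1 : ‖(e : SingularLaneEmden.Space N)‖ = 1 := mem_sphere_zero_iff_norm.mp e.2
  have he : inner ℝ (e : SingularLaneEmden.Space N) (e : SingularLaneEmden.Space N) = (1 : ℝ) := by
    rw [real_inner_self_eq_norm_sq, he1, one_pow]
  have he0 : (e : SingularLaneEmden.Space N) ≠ 0 := by
    rw [← norm_ne_zero_iff, he1]
    exact one_ne_zero
  constructor
  · refine SingularLaneEmden.infinite_of_unbounded_eval e fun A => ?_
    obtain ⟨H, H₁, H₂, hH, hA⟩ := SingularLaneEmden.exists_sphereProfile hp1 ha hosc A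
    exact ⟨_, ⟨hH.isPositiveSphereSolution e,
      SingularLaneEmden.SphereProfile.isAxiallySymmetric e H⟩,
      by simpa only [he] using hA⟩
  · refine SingularLaneEmden.infinite_of_unbounded_eval ⟨(e : SingularLaneEmden.Space N), he0⟩
      fun A => ?_
    -- beyond this value at the pole the profile cannot be constant
    obtain ⟨H, H₁, H₂, hH, hA⟩ := SingularLaneEmden.exists_sphereProfile hp1 ha hosc
      (max A ((|SingularLaneEmden.mu N p| + 1) ^ (1 / (p - 1))))
    refine ⟨_, ⟨SingularLaneEmden.separatedField (2 / (p - 1)) H e,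
      ⟨hH.isPositiveLaneEmdenSolution hp1 e, hH.isSingular (div_pos two_pos (by linarith)) e, ?_,
        _, hH.isPositiveSphereSolution e, SingularLaneEmden.SphereProfile.isAxiallySymmetric e H,
        SingularLaneEmden.SphereProfile.isSeparated p H e⟩, rfl⟩, ?_⟩
    · rintro ⟨f, hf⟩
      have hconst : ∀ σ : SingularLaneEmden.Sphere N,
          H (inner ℝ (e : SingularLaneEmden.Space N) (σ : SingularLaneEmden.Space N)) = H 1 := by
        intro σ
        have h1 : ∀ σ : SingularLaneEmden.Sphere N,
            H (inner ℝ (e : SingularLaneEmden.Space N) (σ : SingularLaneEmden.Space N)) = f 1 := by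
          intro σ
          have hσ : ‖(σ : SingularLaneEmden.Space N)‖ = 1 := mem_sphere_zero_iff_norm.mp σ.2
          rw [← SingularLaneEmden.SphereProfile.separatedField_sphere (2 / (p - 1)) H e σ, hf, hσ]
          rw [← norm_ne_zero_iff, hσ]
          exact one_ne_zero
        rw [h1 σ, ← h1 e, he]
      have h1 := hH.isPositiveSphereSolution e
      simp only [hconst] at h1
      have h2 := h1.rpow_eq_mu_of_const hp1 e
      have h3 : |SingularLaneEmden.mu N p| + 1 ≤ H 1 ^ (p - 1) := by
        have h0 : 0 ≤ |SingularLaneEmden.mu N p| + 1 := by positivity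
        have h4 := Real.rpow_le_rpow (Real.rpow_nonneg h0 _) ((le_max_right _ _).trans hA)
          (by linarith : 0 ≤ p - 1)
        rwa [← Real.rpow_mul h0, one_div_mul_cancel (by linarith), Real.rpow_one] at h4
      linarith [le_abs_self (SingularLaneEmden.mu N p)]
    · have h1 := SingularLaneEmden.SphereProfile.separatedField_sphere (2 / (p - 1)) H e e
      rw [he] at h1
      simp only [Set.domRestrict_apply, h1]
      exact (le_max_left _ _).trans hA
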